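/- Let $d\ge 1$. A tessellation of $\mathbf{R}^d$ is a collection of convex bodies (cells) with pairwise disjoint interiors which covers $\mathbf{R}^d$ and of which only finitely many meet any given bounded set; a random tessellation $\mathfrak{m}$ is a measurable map from a probability space to the set of tessellations, endowed with the $\sigma$-algebra induced by the Fell topology (generated by the numbers of cells in Borel sets of convex bodies). To each cell $C\in\mathfrak{m}$ a point $z(C)$ (its nucleus) is attached in a deterministic, measurable and translation-equivariant way. Let $\mathfrak{m}$ be stationary with intensity $1$, i.e. $\lambda_d(B)^{-1}\,\mathbb{E}[\#\{C\in\mathfrak{m}: z(C)\in B\}]=1$, where $B\subset\mathbf{R}^d$ is a Borel set with $0<\lambda_d(B)<\infty$, and let $\mathcal{C}$ be its typical cell, i.e. a random convex body with $$\mathbb{E}[g(\mathcal{C})]=\frac{1}{\lambda_d(B)}\,\mathbb{E}\Big[\sum_{C\in\mathfrak{m},\,z(C)\in B} g(C-z(C))\Big]$$ for all nonnegative measurable $g$. Let $f$ be a real-valued, measurable, translation invariant function on the convex bodies of $\mathbf{R}^d$. For $\rho>0$ put $\mathbf{W}_\rho=\rho^{1/d}[0,1]^d$ and, for a Borel set $S$,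 let $M_{f,S}=\max_{C\in\mathfrak{m},\,z(C)\in S} f(C)$, with $M_{f,S}=-\infty$ if there is no such cell. Let $\mathbf{C}\supseteq[0,1]^d$ be a cube with sides parallel to the axes, and let $\rho^{1/d}\mathbf{C}$ be divided into a set $V_\rho$ of $N_\rho=n_\rho^d$ sub-cubes $\mathbf{i}=(i_1,\dots,i_d)$ of equal size, where $n_\rho\to\infty$ as $\rho\to\infty$. For $\mathbf{i}\in V_\rho$ let $M_{f,\mathbf{i}}=M_{f,\mathbf{i}\cap\mathbf{W}_\rho}$, and for $I,J\subseteq V_\rho$ let $d(I,J)=\min_{\mathbf{i}\in I,\,\mathbf{j}\in J}\max_{1\le r\le d}|i_r-j_r|$. Assume (Condition 1) that there are an integer $R$ and events $A_\rho$ with $\mathbb{P}(A_\rho)\to1$ as $\rho\to\infty$ such that, for all large $\rho$, conditionally on $A_\rho$, the $\sigma$-algebras $\sigma\{M_{f,\mathbf{i}}:\mathbf{i}\in I\}$ and $\sigma\{M_{f,\mathbf{j}}:\mathbf{j}\in J\}$ are independent whenever $I,J\subseteq V_\rho$ and $d(I,J)>R$. Assume moreover that for every $\tau\ge0$ there are real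 thresholds $v_\rho(\tau)$ such that $\rho\,\mathbb{P}(f(\mathcal{C})>v_\rho(\tau))\to\tau$ as $\rho\to\infty$. Then there exist constants $\theta,\theta'$ with $0\le\theta\le\theta'\le1$ such that, for all $\tau\ge0$, $$\limsup_{\rho\to\infty}\mathbb{P}(M_{f,\mathbf{W}_\rho}\le v_\rho(\tau))=e^{-\theta\tau}\quad\text{and}\quad\liminf_{\rho\to\infty}\mathbb{P}(M_{f,\mathbf{W}_\rho}\le v_\rho(\tau))=e^{-\theta'\tau}.$$ In particular, if $\mathbb{P}(M_{f,\mathbf{W}_\rho}\le v_\rho(\tau))$ converges as $\rho\to\infty$ for some $\tau>0$, then $\theta=\theta'$ and $\mathfrak{m}$ has extremal index $\theta$: for every $\tau\ge0$, $\rho\,\mathbb{P}(f(\mathcal{C})>v_\rho(\tau))\to\tau$ and $\mathbb{P}(M_{f,\mathbf{W}_\rho}\le v_\rho(\tau))\to e^{-\theta\tau}$. -/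

import Mathlib

open Set Filter Topology MeasureTheory ProbabilityTheory
open scoped ENNReal Pointwise

noncomputable section

namespace RandomTessellation

/-- The space `ℝ^d` with its Euclidean norm. -/
abbrev E (d : ℕ) : Type := EuclideanSpace ℝ (Fin d)

/-- The space `𝒦_d` of (nonempty) convex bodies of `ℝ^d`. Mathlib equips it with the Hausdorff
distance. -/
abbrev Body (d : ℕ) : Type := ConvexBody (E d)

/-- The Borel `σ`-algebra of the Hausdorff topology on the convex bodies. -/
instance instMeasurableSpaceBody (d : ℕ) : MeasurableSpace (Body d) := borel (Body d)

instance instBorelSpaceBody (d : ℕ) : BorelSpace (Body d) := ⟨rfl⟩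

/-- The translate `K + x` of a convex body. -/
def shift {d : ℕ} (x : E d) (K : Body d) : Body d where
  carrier := (fun y => y + x) '' (K : Set (E d))
  convex' := by
    have h := K.convex.translate x
    have e : (fun y => y + x) = (fun y => x + y) := by
      funext y
      exact add_comm y x
    rw [e]
    exact h
  isCompact' := K.isCompact.image (continuous_id.add continuous_const)
  nonempty' := K.nonempty.image _

theorem coe_shift {d : ℕ} (x : E d) (K : Body d) :
    (shift x K : Set (E d)) = (Homeomorph.addRight x) '' (K : Set (E d)) := rfl

/-- A tessellation of `ℝ^d`: a collection of convex bodies (the cells) with pairwise disjoint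
interiors which covers the space and such that every bounded set meets finitely many cells. (It is
then automatically countable.) -/
@[ext]
structure Tessellation (d : ℕ) where
  /-- The collection of the cells. -/
  cells : Set (Body d)
  disjoint_interiors : cells.Pairwise fun C D =>
    Disjoint (interior (C : Set (E d))) (interior (D : Set (E d)))
  covers : (⋃ C ∈ cells, (C : Set (E d))) = univ
  locally_finite : ∀ S : Set (E d), Bornology.IsBounded S →
    {C ∈ cells | ((C : Set (E d)) ∩ S).Nonempty}.Finite

/-- The `σ`-algebra on the set of tessellations generated by the numbers of cells in the Borel sets
of convex bodies. For these locally finite collections it is the trace of the Borel `σ`-algebra of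
the Fell topology. -/
instance instMeasurableSpaceTessellation (d : ℕ) : MeasurableSpace (Tessellation d) :=
  ⨆ (A : Set (Body d)) (_ : MeasurableSet A),
    MeasurableSpace.comap (fun m : Tessellation d => (m.cells ∩ A).encard) inferInstance

/-- The tessellation all of whose cells have been translated by `x`. -/
def Tessellation.shift {d : ℕ} (x : E d) (m : Tessellation d) : Tessellation d where
  cells := RandomTessellation.shift x '' m.cells
  disjoint_interiors := by
    rintro _ ⟨C, hC, rfl⟩ _ ⟨D, hD, rfl⟩ hne
    have hCD : C ≠ D := by
      rintro rfl
      exact hne rfl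
    have h := m.disjoint_interiors hC hD hCD
    simp only [coe_shift, ← Homeomorph.image_interior]
    exact (Set.disjoint_image_iff (Homeomorph.addRight x).injective).2 h
  covers := by
    refine eq_univ_of_forall fun y => ?_
    have hy : y - x ∈ (⋃ C ∈ m.cells, (C : Set (E d))) := by
      rw [m.covers]
      trivial
    simp only [mem_iUnion] at hy ⊢
    obtain ⟨C, hC, hyC⟩ := hy
    exact ⟨RandomTessellation.shift x C, ⟨C, hC, rfl⟩, ⟨y - x, hyC, sub_add_cancel y x⟩⟩
  locally_finite := by
    intro S hS
    have hS' : Bornology.IsBounded ((fun y => y + (-x)) '' S) := by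
      obtain ⟨r, hr⟩ := isBounded_iff_forall_norm_le.1 hS
      refine isBounded_iff_forall_norm_le.2 ⟨r + ‖-x‖, ?_⟩
      rintro _ ⟨y, hy, rfl⟩
      exact (norm_add_le _ _).trans (add_le_add (hr y hy) le_rfl)
    refine ((m.locally_finite _ hS').image (RandomTessellation.shift x)).subset ?_
    rintro _ ⟨⟨C, hC, rfl⟩, ⟨_, ⟨y, hy, rfl⟩, hyS⟩⟩
    exact ⟨C, ⟨hC, ⟨y, hy, ⟨y + x, hyS, add_neg_cancel_right y x⟩⟩⟩, rfl⟩

/-- A random tessellation is stationary if its distribution is invariant under the translations. -/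
def IsStationary {d : ℕ} {Ω : Type*} [MeasurableSpace Ω] (P : Measure Ω)
    (𝔪 : Ω → Tessellation d) : Prop :=
  ∀ x : E d, P.map (fun ω => (𝔪 ω).shift x) = P.map 𝔪

/-- A rule attaching, in a measurable way, a nucleus `z m C` to each cell `C` of each tessellation
`m`, and commuting with the translations. (Only the values at the cells of `m` matter.) -/
structure IsNucleus {d : ℕ} (z : Tessellation d → Body d → E d) : Prop where
  measurable : Measurable fun p : Tessellation d × Body d => z p.1 p.2
  equivariant : ∀ (m : Tessellation d) (C : Body d), C ∈ m.cells → ∀ x : E d,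
    z (m.shift x) (shift x C) = z m C + x

/-- The cells of `m` with nucleus in `B`. -/
def cellsIn {d : ℕ} (z : Tessellation d → Body d → E d) (m : Tessellation d) (B : Set (E d)) :
    Set (Body d) :=
  {C | C ∈ m.cells ∧ z m C ∈ B}

/-- The mean number of cells with nucleus in `B`, divided by the volume of `B`. -/
def intensity {d : ℕ} {Ω : Type*} [MeasurableSpace Ω] (P : Measure Ω) (𝔪 : Ω → Tessellation d)
    (z : Tessellation d → Body d → E d) (B : Set (E d)) : ℝ≥0∞ :=
  (∫⁻ ω, ((cellsIn z (𝔪 ω) B).encard : ℝ≥0∞) ∂P) / volume B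

/-- The random convex body `𝒞`, defined on a probability space `(Ω', P')`, is distributed as the
typical cell of the random tessellation `𝔪` of intensity one:
`E[g(𝒞)] = λ(B)⁻¹ E[∑_{C ∈ 𝔪, z(C) ∈ B} g(C - z(C))]` for every nonnegative measurable `g`. -/
structure IsTypicalCell {d : ℕ} {Ω Ω' : Type*} [MeasurableSpace Ω] [MeasurableSpace Ω']
    (P : Measure Ω) (𝔪 : Ω → Tessellation d) (z : Tessellation d → Body d → E d) (B : Set (E d))
    (P' : Measure Ω') (𝒞 : Ω' → Body d) : Prop where
  measurable : Measurable 𝒞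
  campbell : ∀ g : Body d → ℝ≥0∞, Measurable g →
    ∫⁻ ω', g (𝒞 ω') ∂P' =
      (∫⁻ ω, ∑' C : cellsIn z (𝔪 ω) B, g (shift (-(z (𝔪 ω) C)) C) ∂P) / volume B

/-- The maximum of `f` over the cells of `m` with nucleus in `B`, with value `-∞` if there are no
such cells. -/
def maxOver {d : ℕ} (z : Tessellation d → Body d → E d) (f : Body d → ℝ) (B : Set (E d))
    (m : Tessellation d) : EReal :=
  ⨆ C ∈ cellsIn z m B, (f C : EReal)

/-- The cube `∏_r [a_r, a_r + s]`. -/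
def cube {d : ℕ} (a : E d) (s : ℝ) : Set (E d) :=
  {x | ∀ r, a r ≤ x r ∧ x r ≤ a r + s}

/-- The window `𝐖_ρ = ρ^{1/d} W` for `W = [0,1]^d`. -/
def window (d : ℕ) (ρ : ℝ) : Set (E d) :=
  (ρ ^ ((1 : ℝ) / d)) • cube 0 1

/-- The sub-cube of index `i` in the subdivision of `ρ^{1/d} ∏_r [a_r, a_r + s]` into `n^d` cubes
of equal size. -/
def subCube {d : ℕ} (a : E d) (s ρ : ℝ) (n : ℕ) (i : Fin d → Fin n) : Set (E d) :=
  (ρ ^ ((1 : ℝ) / d)) • cube (WithLp.toLp 2 fun r => a r + (s / n) * ((i r : ℕ) : ℝ)) (s / n)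

/-- The distance `max_r |i_r - j_r|` between the indices of two sub-cubes. -/
def indexDist {d n : ℕ} (i j : Fin d → Fin n) : ℕ :=
  Finset.univ.sup fun r => (((i r : ℕ) : ℤ) - ((j r : ℕ) : ℤ)).natAbs

/-- The `σ`-algebra generated by the maxima `M_{f,i}`, `i ∈ I`, where `M_{f,i}` is the maximum of
`f` over the cells with nucleus in the intersection of the sub-cube `i` with `𝐖_ρ`. -/
@[reducible] def sigmaMax {d : ℕ} {Ω : Type*} (𝔪 : Ω → Tessellation d) (z : Tessellation d → Body d → E d)
    (f : Body d → ℝ) (a : E d) (s ρ : ℝ) (n : ℕ) (I : Set (Fin d → Fin n)) : MeasurableSpace Ω :=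
  ⨆ i ∈ I, MeasurableSpace.comap
    (fun ω => maxOver z f (subCube a s ρ n i ∩ window d ρ) (𝔪 ω)) inferInstance

/-- The condition of `R`-dependence: there are an integer `R` and events `A ρ` of probability
tending to `1` such that (for large `ρ`), conditionally on `A ρ`, the maxima of `f` over the
sub-cubes of `I` and over those of `J` are independent if `I` and `J` are at distance greater than
`R`. Here `ρ^{1/d} ∏_r [a_r, a_r + s]` is subdivided into `(n ρ)^d` sub-cubes. -/
def RDependent {d : ℕ} {Ω : Type*} [MeasurableSpace Ω] (P : Measure Ω) (𝔪 : Ω → Tessellation d)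
    (z : Tessellation d → Body d → E d) (f : Body d → ℝ) (a : E d) (s : ℝ) (n : ℝ → ℕ) : Prop :=
  ∃ (R : ℕ) (A : ℝ → Set Ω),
    (∀ ρ, MeasurableSet (A ρ)) ∧
    Tendsto (fun ρ => P (A ρ)) atTop (𝓝 1) ∧
    ∀ᶠ ρ in atTop, ∀ I J : Set (Fin d → Fin (n ρ)),
      (∀ i ∈ I, ∀ j ∈ J, R < indexDist i j) →
        Indep (sigmaMax 𝔪 z f a s ρ (n ρ) I) (sigmaMax 𝔪 z f a s ρ (n ρ) J)
          (ProbabilityTheory.cond P (A ρ))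

/-- The probability `P(M_{f,𝐖_ρ} ≤ t)`. -/
def probMaxLe {d : ℕ} {Ω : Type*} [MeasurableSpace Ω] (P : Measure Ω) (𝔪 : Ω → Tessellation d)
    (z : Tessellation d → Body d → E d) (f : Body d → ℝ) (ρ t : ℝ) : ℝ :=
  P.real {ω | maxOver z f (window d ρ) (𝔪 ω) ≤ (t : EReal)}

/-- The thresholds `v τ ρ`, `τ ≥ 0`, are such that `ρ P(f(𝒞) > v τ ρ)` converges to `τ`. -/
def AreThresholds {d : ℕ} {Ω' : Type*} [MeasurableSpace Ω'] (P' : Measure Ω') (𝒞 : Ω' → Body d)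
    (f : Body d → ℝ) (v : ℝ → ℝ → ℝ) : Prop :=
  ∀ τ : ℝ, 0 ≤ τ → Tendsto (fun ρ : ℝ => ρ * P'.real {ω' | v τ ρ < f (𝒞 ω')}) atTop (𝓝 τ)

/-- The random tessellation has extremal index `θ` (relative to the thresholds `v`). -/
def HasExtremalIndex {d : ℕ} {Ω Ω' : Type*} [MeasurableSpace Ω] [MeasurableSpace Ω']
    (P : Measure Ω) (𝔪 : Ω → Tessellation d) (z : Tessellation d → Body d → E d)
    (P' : Measure Ω') (𝒞 : Ω' → Body d) (f : Body d → ℝ) (v : ℝ → ℝ → ℝ) (θ : ℝ) : Prop :=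
  AreThresholds P' 𝒞 f v ∧
    ∀ τ : ℝ, 0 ≤ τ →
      Tendsto (fun ρ : ℝ => probMaxLe P 𝔪 z f ρ (v τ ρ)) atTop (𝓝 (Real.exp (-θ * τ)))

end RandomTessellation

end

/-! The law of the maximum satisfies a functional equation whose only solutions are exponentials.
Put K = k^d and cut the window `𝐖_ρ` into K translates of `𝐖_{ρ/K}`. From each block remove a strip
along its faces, wide enough that the sub-cubes kept in different blocks are more than R apart.
Conditionally on `A ρ` the maxima over the trimmed blocks are independent. The strips occupy a
vanishing fraction of the window, so the mean number of exceedances with nucleus in them tends to 0.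
Hence P(M_ρ ≤ v_ρ(τ)) = P(M_{ρ/K} ≤ v_ρ(τ))^K + o(1); the quantitative form is
`abs_probLe_window_sub_pow_le`.

All error terms rest on one identity, `meanCount_eq`: for translation invariant G, the mean number
of cells in G with nucleus in S is vol(S) P'(𝒞 ∈ G). With Markov's inequality it bounds the effect
of changing the region or the threshold. In particular v_ρ(τ) may be replaced by v_{ρ/K}(τ/K), since
both give asymptotically τ/K exceedances per block.

Let ψ(τ) be the upper limit, or the lower limit, of P(M_ρ ≤ v_ρ(τ)). Then ψ(τ) = ψ(τ/K)^K, ψ is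
1-Lipschitz, and 1 - τ ≤ ψ(τ) ≤ 1. By `exists_eq_exp_of_pow_eq`, ψ(τ) = exp(-θτ) with θ in [0,1].
The two limits are handled together through `IsLimitFunctional`. -/

namespace RandomTessellation

/-! ### Translations of convex bodies and of tessellations -/

theorem shift_injective {d : ℕ} (x : E d) : Function.Injective (shift x : Body d → Body d) := by
  intro K L h
  apply SetLike.coe_injective
  have h' : (shift x K : Set (E d)) = shift x L := by rw [h]
  rw [coe_shift, coe_shift] at h'
  exact (Homeomorph.addRight x).injective.image_injective h'

theorem isometry_shift {d : ℕ} (x : E d) : Isometry (shift x : Body d → Body d) := by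
  refine Isometry.of_dist_eq fun K L => ?_
  rw [← ConvexBody.hausdorffDist_coe, ← ConvexBody.hausdorffDist_coe]
  exact Metric.hausdorffDist_image (isometry_add_right x)

theorem measurable_shift {d : ℕ} (x : E d) : Measurable (shift x : Body d → Body d) :=
  (isometry_shift x).continuous.measurable

theorem measurable_encard_inter {d : ℕ} {A : Set (Body d)} (hA : MeasurableSet A) :
    Measurable fun m : Tessellation d => (m.cells ∩ A).encard :=
  Measurable.of_comap_le (le_iSup₂_of_le (f := fun (A : Set (Body d)) (_ : MeasurableSet A) =>
    MeasurableSpace.comap (fun m : Tessellation d => (m.cells ∩ A).encard) inferInstance)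
    A hA le_rfl)

theorem measurable_of_encard {d : ℕ} {α : Type*} [MeasurableSpace α] {F : α → Tessellation d}
    (h : ∀ A, MeasurableSet A → Measurable fun a => ((F a).cells ∩ A).encard) : Measurable F := by
  refine measurable_iff_comap_le.2 ?_
  simp only [instMeasurableSpaceTessellation, MeasurableSpace.comap_iSup, iSup_le_iff,
    MeasurableSpace.comap_comp]
  exact fun A hA => (h A hA).comap_le

theorem measurable_tessellation_shift {d : ℕ} (x : E d) :
    Measurable (Tessellation.shift x : Tessellation d → Tessellation d) := by
  refine measurable_of_encard fun A hA => ?_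
  have h : ∀ m : Tessellation d, ((m.shift x).cells ∩ A).encard =
      (m.cells ∩ shift x ⁻¹' A).encard := by
    intro m
    rw [← (shift_injective x).encard_image (m.cells ∩ shift x ⁻¹' A),
      image_inter_preimage]
    rfl
  simp only [h]
  exact measurable_encard_inter (measurable_shift x hA)

/-! ### The counting kernel of the cells -/

/-- The convex bodies which meet the closed ball of radius `r` about the origin. -/
def hitting (d : ℕ) (r : ℝ) : Set (Body d) := {K | Metric.infDist (0 : E d) K ≤ r}

theorem measurableSet_hitting {d : ℕ} (r : ℝ) : MeasurableSet (hitting d r) := by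
  have h : LipschitzWith 1 fun K : Body d => Metric.infDist (0 : E d) K := by
    refine LipschitzWith.of_le_add fun K L => ?_
    rw [dist_comm, ← ConvexBody.hausdorffDist_coe]
    exact Metric.infDist_le_infDist_add_hausdorffDist ConvexBody.hausdorffEDist_ne_top
  exact measurableSet_le h.continuous.measurable measurable_const

theorem finite_inter_hitting {d : ℕ} (m : Tessellation d) (r : ℝ) :
    (m.cells ∩ hitting d r).Finite := by
  refine (m.locally_finite (Metric.closedBall 0 r) Metric.isBounded_closedBall).subset ?_
  rintro K ⟨hK, hKr⟩
  refine ⟨hK, ?_⟩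
  obtain ⟨y, hy, hyd⟩ := K.isCompact.exists_infDist_eq_dist K.nonempty (0 : E d)
  refine ⟨y, hy, ?_⟩
  rw [Metric.mem_closedBall, dist_comm, ← hyd]
  exact hKr

theorem iUnion_hitting (d : ℕ) : ⋃ n : ℕ, hitting d n = univ :=
  iUnion_eq_univ_iff.2 fun K => exists_nat_ge (Metric.infDist (0 : E d) K)

theorem countable_cells {d : ℕ} (m : Tessellation d) : m.cells.Countable := by
  rw [← inter_univ m.cells, ← iUnion_hitting, inter_iUnion]
  exact countable_iUnion fun n => (finite_inter_hitting m n).countable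

theorem measurableSet_cells {d : ℕ} (m : Tessellation d) : MeasurableSet m.cells :=
  (countable_cells m).measurableSet

theorem count_restrict_cells {d : ℕ} (m : Tessellation d) {A : Set (Body d)}
    (hA : MeasurableSet A) :
    Measure.count.restrict m.cells A = ((m.cells ∩ A).encard : ℝ≥0∞) := by
  rw [Measure.restrict_apply hA, Measure.count_apply (hA.inter (measurableSet_cells m)), inter_comm]

/-- The kernel which maps a tessellation to the counting measure on its cells. -/
noncomputable def cellKernel (d : ℕ) : Kernel (Tessellation d) (Body d) where
  toFun m := Measure.count.restrict m.cells
  measurable' := by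
    refine Measure.measurable_of_measurable_coe _ fun A hA => ?_
    simp only [count_restrict_cells _ hA]
    exact (measurable_from_top (f := fun n : ℕ∞ => (n : ℝ≥0∞))).comp (measurable_encard_inter hA)

theorem cellKernel_apply {d : ℕ} (m : Tessellation d) {A : Set (Body d)} (hA : MeasurableSet A) :
    cellKernel d m A = ((m.cells ∩ A).encard : ℝ≥0∞) :=
  count_restrict_cells m hA

/-- The masses κ a need not be uniformly bounded. Splitting the source by the rounded-up total mass
makes each piece of κ a finite kernel. -/
theorem isSFiniteKernel_of_isFiniteMeasure {α β : Type*} [MeasurableSpace α] [MeasurableSpace β]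
    (κ : Kernel α β) (h : ∀ a, IsFiniteMeasure (κ a)) : IsSFiniteKernel κ := by
  classical
  have hm : Measurable fun a => ⌈(κ a univ).toReal⌉₊ :=
    Nat.measurable_ceil.comp (κ.measurable_coe MeasurableSet.univ).ennreal_toReal
  have hs : ∀ k : ℕ, MeasurableSet {a | ⌈(κ a univ).toReal⌉₊ = k} := fun k =>
    hm (measurableSet_singleton k)
  let κ' : ℕ → Kernel α β := fun k => Kernel.piecewise (hs k) κ 0
  have hfin : ∀ k, IsFiniteKernel (κ' k) := by
    intro k
    refine ⟨⟨k, ENNReal.natCast_lt_top k, fun a => ?_⟩⟩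
    simp only [κ', Kernel.piecewise_apply]
    split_ifs with hk
    · rw [← ENNReal.ofReal_toReal (measure_ne_top (κ a) univ), ← ENNReal.ofReal_natCast]
      refine ENNReal.ofReal_le_ofReal ?_
      rw [← hk]
      exact Nat.le_ceil _
    · simp
  have hsum : κ = Kernel.sum κ' := by
    ext a A hA
    rw [Kernel.sum_apply' _ _ hA, tsum_eq_single ⌈(κ a univ).toReal⌉₊]
    · simp [κ', Kernel.piecewise_apply]
    · intro k hk
      have : ¬ (a ∈ {a | ⌈(κ a univ).toReal⌉₊ = k}) := fun h => hk h.symm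
      simp only [κ', Kernel.piecewise_apply, if_neg this]
      simp
  rw [hsum]
  infer_instance

/-- Bodies are sorted into shells by their distance from the origin; local finiteness leaves
finitely many cells of a tessellation in each shell. -/
instance isSFiniteKernel_cellKernel (d : ℕ) : IsSFiniteKernel (cellKernel d) := by
  let A : ℕ → Set (Body d) := disjointed fun n : ℕ => hitting d n
  have hA : ∀ n, MeasurableSet (A n) :=
    fun n => MeasurableSet.disjointed (fun i : ℕ => measurableSet_hitting (i : ℝ)) n
  have hfin : ∀ n, IsSFiniteKernel ((cellKernel d).restrict (hA n)) := by
    intro n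
    refine isSFiniteKernel_of_isFiniteMeasure _ fun m => ⟨?_⟩
    rw [Kernel.restrict_apply, Measure.restrict_apply_univ, cellKernel_apply m (hA n)]
    have : (m.cells ∩ A n).Finite :=
      (finite_inter_hitting m n).subset (inter_subset_inter_right _ (disjointed_subset _ n))
    rw [this.encard_eq_coe]
    exact ENNReal.natCast_lt_top _
  have hsum : cellKernel d = Kernel.sum fun n => (cellKernel d).restrict (hA n) := by
    ext m G hG
    rw [Kernel.sum_apply' _ _ hG]
    simp only [Kernel.restrict_apply]
    have hU : ⋃ n, A n = univ := by rw [iUnion_disjointed, iUnion_hitting]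
    rw [← Measure.sum_apply _ hG, ← Measure.restrict_iUnion (disjoint_disjointed _) hA, hU,
      Measure.restrict_univ]
  rw [hsum]
  infer_instance

theorem measurableSet_cellsIn_slice {d : ℕ} {z : Tessellation d → Body d → E d} (hz : IsNucleus z)
    {S : Set (E d)} (hS : MeasurableSet S) {G : Set (Body d)} (hG : MeasurableSet G) :
    MeasurableSet {p : Tessellation d × Body d | z p.1 p.2 ∈ S ∧ p.2 ∈ G} :=
  (hz.measurable hS).inter (measurable_snd hG)

theorem cellKernel_slice {d : ℕ} {z : Tessellation d → Body d → E d} (hz : IsNucleus z)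
    {S : Set (E d)} (hS : MeasurableSet S) {G : Set (Body d)} (hG : MeasurableSet G)
    (m : Tessellation d) :
    cellKernel d m (Prod.mk m ⁻¹' {p : Tessellation d × Body d | z p.1 p.2 ∈ S ∧ p.2 ∈ G}) =
      ((cellsIn z m S ∩ G).encard : ℝ≥0∞) := by
  rw [cellKernel_apply m (measurable_prodMk_left (measurableSet_cellsIn_slice hz hS hG))]
  congr 2
  ext C
  simp [cellsIn, and_assoc]

/-- The nucleus depends on the whole tessellation, so this is not one of the counts that generate
the `σ`-algebra. It is the mass that the s-finite kernel `cellKernel` gives to a section of a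
measurable set of pairs, and such masses are measurable. -/
theorem measurable_encard_cellsIn {d : ℕ} {z : Tessellation d → Body d → E d} (hz : IsNucleus z)
    {S : Set (E d)} (hS : MeasurableSet S) {G : Set (Body d)} (hG : MeasurableSet G) :
    Measurable fun m => ((cellsIn z m S ∩ G).encard : ℝ≥0∞) := by
  simp only [← cellKernel_slice hz hS hG]
  exact Kernel.measurable_kernel_prodMk_left (measurableSet_cellsIn_slice hz hS hG)

/-! ### The mean number of cells -/

/-- The mean number of cells of `𝔪` which lie in `G` and whose nucleus lies in `S`. -/
noncomputable def meanCount {d : ℕ} {Ω : Type*} [MeasurableSpace Ω] (P : Measure Ω)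
    (𝔪 : Ω → Tessellation d) (z : Tessellation d → Body d → E d) (G : Set (Body d))
    (S : Set (E d)) : ℝ≥0∞ :=
  ∫⁻ ω, ((cellsIn z (𝔪 ω) S ∩ G).encard : ℝ≥0∞) ∂P

section

variable {d : ℕ} {Ω Ω' : Type*} [MeasurableSpace Ω] [MeasurableSpace Ω']
  {P : Measure Ω} {P' : Measure Ω'}
  {𝔪 : Ω → Tessellation d} {z : Tessellation d → Body d → E d}
  {G : Set (Body d)}

/-- The measure is the image under the nucleus map of the Campbell measure on pairs (tessellation,
cell), restricted to cells in G. S-finiteness is what Tonelli's theorem needs below. -/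
theorem exists_sFinite_eq_meanCount [IsProbabilityMeasure P] (h𝔪 : Measurable 𝔪) (hz : IsNucleus z)
    (hG : MeasurableSet G) :
    ∃ μ : Measure (E d), SFinite μ ∧ ∀ S, MeasurableSet S → μ S = meanCount P 𝔪 z G S := by
  have := Measure.isProbabilityMeasure_map (μ := P) h𝔪.aemeasurable
  have hG' : MeasurableSet {p : Tessellation d × Body d | p.2 ∈ G} := measurable_snd hG
  refine ⟨((((P.map 𝔪) ⊗ₘ cellKernel d).restrict {p | p.2 ∈ G}).map fun p => z p.1 p.2),
    inferInstance, fun S hS => ?_⟩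
  have hS' := hz.measurable hS
  rw [Measure.map_apply hz.measurable hS, Measure.restrict_apply hS']
  change ((P.map 𝔪) ⊗ₘ cellKernel d) {p | z p.1 p.2 ∈ S ∧ p.2 ∈ G} = _
  rw [Measure.compProd_apply (measurableSet_cellsIn_slice hz hS hG)]
  simp only [cellKernel_slice hz hS hG]
  exact lintegral_map (measurable_encard_cellsIn hz hS hG) h𝔪

theorem cellsIn_shift (hz : IsNucleus z) (m : Tessellation d) (x : E d) (S : Set (E d)) :
    cellsIn z (m.shift x) S = shift x '' cellsIn z m ((fun y => y + x) ⁻¹' S) := by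
  ext C
  constructor
  · rintro ⟨⟨D, hD, rfl⟩, hS⟩
    refine ⟨D, ⟨hD, ?_⟩, rfl⟩
    rwa [hz.equivariant m D hD x] at hS
  · rintro ⟨D, ⟨hD, hS⟩, rfl⟩
    refine ⟨⟨D, hD, rfl⟩, ?_⟩
    rwa [hz.equivariant m D hD x]

theorem encard_cellsIn_shift (hz : IsNucleus z) (hinv : ∀ C x, shift x C ∈ G ↔ C ∈ G)
    (m : Tessellation d) (x : E d) (S : Set (E d)) :
    (cellsIn z (m.shift x) S ∩ G).encard =
      (cellsIn z m ((fun y => y + x) ⁻¹' S) ∩ G).encard := by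
  have hG : shift x ⁻¹' G = G := by
    ext C
    exact hinv C x
  rw [cellsIn_shift hz, ← image_inter_preimage, hG, (shift_injective x).encard_image]

theorem lintegral_shift (h𝔪 : Measurable 𝔪) (hstat : IsStationary P 𝔪) (x : E d)
    {F : Tessellation d → ℝ≥0∞} (hF : Measurable F) :
    ∫⁻ ω, F ((𝔪 ω).shift x) ∂P = ∫⁻ ω, F (𝔪 ω) ∂P := by
  rw [← lintegral_map hF h𝔪, ← hstat x]
  exact (lintegral_map hF ((measurable_tessellation_shift x).comp h𝔪)).symm

theorem meanCount_preimage_add (h𝔪 : Measurable 𝔪) (hstat : IsStationary P 𝔪)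
    (hz : IsNucleus z) (hG : MeasurableSet G) (hinv : ∀ C x, shift x C ∈ G ↔ C ∈ G)
    {S : Set (E d)} (hS : MeasurableSet S) (x : E d) :
    meanCount P 𝔪 z G ((fun y => y + x) ⁻¹' S) = meanCount P 𝔪 z G S := by
  have h := lintegral_shift h𝔪 hstat x (measurable_encard_cellsIn hz hS hG)
  simp only [encard_cellsIn_shift hz hinv] at h
  exact h

/-- Double counting: integrate μ(S ∩ (B + x)) over x. Integrating over x first gives μ(S) vol(B);
moving the translation onto S by invariance gives μ(B) vol(S). No local finiteness of μ is required,
unlike in the uniqueness of Haar measure. -/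
theorem measure_mul_volume_eq {μ : Measure (E d)} [SFinite μ]
    (hμ : ∀ S, MeasurableSet S → ∀ x, μ ((fun y => y + x) ⁻¹' S) = μ S)
    {S B : Set (E d)} (hS : MeasurableSet S) (hB : MeasurableSet B) :
    μ S * volume B = μ B * volume S := by
  have h1 : ∀ x : E d, μ (S ∩ (fun y => y + -x) ⁻¹' B) = μ ((fun y => y + x) ⁻¹' S ∩ B) := by
    intro x
    rw [← hμ _ (hS.inter ((measurable_add_const (-x)) hB)) x]
    congr 1
    ext y
    simp
  have hm1 : MeasurableSet {p : E d × E d | p.2 ∈ S ∧ p.2 + -p.1 ∈ B} :=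
    (measurable_snd hS).inter ((measurable_snd.add measurable_fst.neg) hB)
  have hm2 : MeasurableSet {p : E d × E d | p.2 + p.1 ∈ S ∧ p.2 ∈ B} :=
    ((measurable_snd.add measurable_fst) hS).inter (measurable_snd hB)
  have e : (volume.prod μ) {p : E d × E d | p.2 ∈ S ∧ p.2 + -p.1 ∈ B} =
      (volume.prod μ) {p : E d × E d | p.2 + p.1 ∈ S ∧ p.2 ∈ B} := by
    rw [Measure.prod_apply hm1, Measure.prod_apply hm2]
    exact lintegral_congr h1
  rw [Measure.prod_apply_symm hm1, Measure.prod_apply_symm hm2] at e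
  have e1 : ∀ y : E d, volume ((fun x => (x, y)) ⁻¹' {p : E d × E d | p.2 ∈ S ∧ p.2 + -p.1 ∈ B}) =
      S.indicator (fun _ => volume B) y := by
    intro y
    by_cases hy : y ∈ S
    · rw [indicator_of_mem hy, ←
        (Measure.measurePreserving_sub_left volume y).measure_preimage hB.nullMeasurableSet]
      congr 1
      ext x
      simp [hy, sub_eq_add_neg]
    · simp [hy]
  have e2 : ∀ y : E d, volume ((fun x => (x, y)) ⁻¹' {p : E d × E d | p.2 + p.1 ∈ S ∧ p.2 ∈ B}) =
      B.indicator (fun _ => volume S) y := by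
    intro y
    by_cases hy : y ∈ B
    · rw [indicator_of_mem hy, ← measure_preimage_add volume y S]
      congr 1
      ext x
      simp [hy]
    · simp [hy]
  simp only [e1, e2, lintegral_indicator_const hS, lintegral_indicator_const hB] at e
  rw [mul_comm, e, mul_comm]

/-- For the indicator of an invariant set, centring a cell at its nucleus changes nothing, so the
Campbell sum is a plain count. -/
theorem meanCount_eq_of_campbell {B : Set (E d)} {𝒞 : Ω' → Body d}
    (hB0 : volume B ≠ 0) (hBtop : volume B ≠ ∞)
    (h𝒞 : IsTypicalCell P 𝔪 z B P' 𝒞)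
    (hG : MeasurableSet G) (hinv : ∀ C x, shift x C ∈ G ↔ C ∈ G) :
    meanCount P 𝔪 z G B = volume B * P' (𝒞 ⁻¹' G) := by
  have h := h𝒞.campbell (G.indicator 1) (measurable_one.indicator hG)
  have hl : ∫⁻ ω', G.indicator 1 (𝒞 ω') ∂P' = P' (𝒞 ⁻¹' G) := by
    rw [← lintegral_indicator_one (h𝒞.measurable hG)]
    rfl
  have hr : ∀ ω, ∑' C : cellsIn z (𝔪 ω) B,
      G.indicator (1 : Body d → ℝ≥0∞) (shift (-(z (𝔪 ω) C)) C) =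
      ((cellsIn z (𝔪 ω) B ∩ G).encard : ℝ≥0∞) := by
    intro ω
    have : ∀ (C : Body d) (x : E d),
        G.indicator (1 : Body d → ℝ≥0∞) (shift x C) = G.indicator 1 C := by
      intro C x
      by_cases hC : C ∈ G
      · rw [indicator_of_mem hC, indicator_of_mem ((hinv C x).2 hC)]
        rfl
      · rw [indicator_of_notMem hC, indicator_of_notMem fun h' => hC ((hinv C x).1 h')]
    simp only [this]
    rw [tsum_subtype (cellsIn z (𝔪 ω) B) (G.indicator 1), ← ENNReal.tsum_set_one,
      tsum_subtype (cellsIn z (𝔪 ω) B ∩ G) (fun _ => (1 : ℝ≥0∞)), indicator_indicator]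
    rfl
  rw [hl] at h
  simp only [hr] at h
  rw [h, meanCount, ENNReal.mul_div_cancel hB0 hBtop]

theorem meanCount_eq [IsProbabilityMeasure P] (h𝔪 : Measurable 𝔪) (hstat : IsStationary P 𝔪) (hz : IsNucleus z)
    {B : Set (E d)} (hB : MeasurableSet B) (hB0 : volume B ≠ 0) (hBtop : volume B ≠ ∞)
    {𝒞 : Ω' → Body d} (h𝒞 : IsTypicalCell P 𝔪 z B P' 𝒞)
    (hG : MeasurableSet G) (hinv : ∀ C x, shift x C ∈ G ↔ C ∈ G)
    {S : Set (E d)} (hS : MeasurableSet S) :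
    meanCount P 𝔪 z G S = volume S * P' (𝒞 ⁻¹' G) := by
  obtain ⟨μ, hμ, h⟩ := exists_sFinite_eq_meanCount (P := P) h𝔪 hz hG
  have e := measure_mul_volume_eq (μ := μ) (fun T hT x => by
    rw [h _ (measurable_add_const x hT), h _ hT, meanCount_preimage_add h𝔪 hstat hz hG hinv hT]) hS hB
  rw [h S hS, h B hB, meanCount_eq_of_campbell hB0 hBtop h𝒞 hG hinv] at e
  rw [← ENNReal.mul_left_inj hB0 hBtop, e]
  ring

end

/-! ### The distribution of the maximum -/

theorem maxOver_le_iff {d : ℕ} {z : Tessellation d → Body d → E d} {f : Body d → ℝ} {S : Set (E d)}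
    {m : Tessellation d} {u : ℝ} :
    maxOver z f S m ≤ (u : EReal) ↔ ∀ C ∈ cellsIn z m S, f C ≤ u := by
  simp [maxOver, iSup_le_iff]

theorem cellsIn_mono {d : ℕ} {z : Tessellation d → Body d → E d} {S T : Set (E d)} (h : S ⊆ T)
    (m : Tessellation d) : cellsIn z m S ⊆ cellsIn z m T :=
  fun _ hC => ⟨hC.1, h hC.2⟩

theorem maxOver_iUnion_le_iff {d : ℕ} {z : Tessellation d → Body d → E d} {f : Body d → ℝ}
    {ι : Type*} {I : Set ι} {S : ι → Set (E d)} {m : Tessellation d} {u : ℝ} :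
    maxOver z f (⋃ i ∈ I, S i) m ≤ (u : EReal) ↔ ∀ i ∈ I, maxOver z f (S i) m ≤ (u : EReal) := by
  simp only [maxOver_le_iff, cellsIn, mem_iUnion, mem_ofPred_eq]
  constructor
  · rintro h i hi C ⟨hC, hz⟩
    exact h C ⟨hC, i, hi, hz⟩
  · rintro h C ⟨hC, i, hi, hz⟩
    exact h i hi C ⟨hC, hz⟩

/-- The probability that the maximum over the cells with nucleus in `S` is at most `u`. -/
noncomputable def probLe {d : ℕ} {Ω : Type*} [MeasurableSpace Ω] (P : Measure Ω)
    (𝔪 : Ω → Tessellation d) (z : Tessellation d → Body d → E d) (f : Body d → ℝ)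
    (S : Set (E d)) (u : ℝ) : ℝ :=
  P.real {ω | maxOver z f S (𝔪 ω) ≤ (u : EReal)}

/-- The mean numbers of cells in translation invariant sets `G` of convex bodies and with nucleus
in `S` is the product of the volume of `S` and of the probability that `𝒞` belongs to `G`. -/
def HasProductIntensity {d : ℕ} {Ω Ω' : Type*} [MeasurableSpace Ω] [MeasurableSpace Ω']
    (P : Measure Ω) (P' : Measure Ω') (𝔪 : Ω → Tessellation d)
    (z : Tessellation d → Body d → E d) (𝒞 : Ω' → Body d) : Prop :=
  ∀ G : Set (Body d), MeasurableSet G → (∀ C x, shift x C ∈ G ↔ C ∈ G) →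
    ∀ S : Set (E d), MeasurableSet S → meanCount P 𝔪 z G S = volume S * P' (𝒞 ⁻¹' G)

section

variable {d : ℕ} {Ω Ω' : Type*} [MeasurableSpace Ω] [MeasurableSpace Ω']
  {P : Measure Ω} {P' : Measure Ω'}
  {𝔪 : Ω → Tessellation d} {z : Tessellation d → Body d → E d} {𝒞 : Ω' → Body d} {f : Body d → ℝ}

/-- The event says that the number of cells exceeding u vanishes, and that number is measurable. -/
theorem measurableSet_maxOver_le (hz : IsNucleus z) (hf : Measurable f) {S : Set (E d)}
    (hS : MeasurableSet S) (u : ℝ) :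
    MeasurableSet {m : Tessellation d | maxOver z f S m ≤ (u : EReal)} := by
  have hG : MeasurableSet {C | u < f C} := measurableSet_lt measurable_const hf
  have h : {m : Tessellation d | maxOver z f S m ≤ (u : EReal)} =
      (fun m => ((cellsIn z m S ∩ {C | u < f C}).encard : ℝ≥0∞)) ⁻¹' {0} := by
    ext m
    simp only [mem_ofPred_eq, maxOver_le_iff, mem_preimage, mem_singleton_iff, ENat.toENNReal_eq_zero,
      encard_eq_zero, eq_empty_iff_forall_notMem, mem_inter_iff, not_and, not_lt]
  rw [h]
  exact measurable_encard_cellsIn hz hS hG (measurableSet_singleton 0)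

theorem measurableSet_maxOver_le' (h𝔪 : Measurable 𝔪) (hz : IsNucleus z) (hf : Measurable f)
    {S : Set (E d)} (hS : MeasurableSet S) (u : ℝ) :
    MeasurableSet {ω | maxOver z f S (𝔪 ω) ≤ (u : EReal)} :=
  h𝔪 (measurableSet_maxOver_le hz hf hS u)

theorem probLe_le_one [IsProbabilityMeasure P] {S : Set (E d)} {u : ℝ} : probLe P 𝔪 z f S u ≤ 1 := measureReal_le_one

theorem probLe_nonneg {S : Set (E d)} {u : ℝ} : 0 ≤ probLe P 𝔪 z f S u := measureReal_nonneg

theorem probLe_anti [IsProbabilityMeasure P] {S T : Set (E d)} (h : S ⊆ T) {u : ℝ} :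
    probLe P 𝔪 z f T u ≤ probLe P 𝔪 z f S u := by
  refine measureReal_mono fun ω hω => ?_
  simp only [mem_ofPred_eq, maxOver_le_iff] at hω ⊢
  exact fun C hC => hω C (cellsIn_mono h _ hC)

theorem probLe_mono [IsProbabilityMeasure P] {S : Set (E d)} {u v : ℝ} (h : u ≤ v) :
    probLe P 𝔪 z f S u ≤ probLe P 𝔪 z f S v :=
  measureReal_mono fun _ hω => le_trans hω (EReal.coe_le_coe_iff.2 h)

theorem probLe_preimage_add (h𝔪 : Measurable 𝔪) (hstat : IsStationary P 𝔪)
    (hz : IsNucleus z) (hf : Measurable f) (hfinv : ∀ C x, f (shift x C) = f C)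
    {S : Set (E d)} (hS : MeasurableSet S) (x : E d) (u : ℝ) :
    probLe P 𝔪 z f ((fun y => y + x) ⁻¹' S) u = probLe P 𝔪 z f S u := by
  have hm := measurableSet_maxOver_le hz hf hS u
  have h1 : P {ω | maxOver z f S (𝔪 ω) ≤ (u : EReal)} =
      P.map 𝔪 {m | maxOver z f S m ≤ (u : EReal)} := (Measure.map_apply h𝔪 hm).symm
  have h2 : P {ω | maxOver z f ((fun y => y + x) ⁻¹' S) (𝔪 ω) ≤ (u : EReal)} =
      P.map (fun ω => (𝔪 ω).shift x) {m | maxOver z f S m ≤ (u : EReal)} := by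
    refine Eq.trans ?_ (Measure.map_apply ((measurable_tessellation_shift x).comp h𝔪) hm).symm
    congr 1
    ext ω
    simp [maxOver_le_iff, cellsIn_shift hz, hfinv]
  simp only [probLe, Measure.real]
  rw [h1, h2, hstat x]

/-- Markov's inequality: P(N ≥ 1) ≤ E[N] for the number N of such cells. -/
theorem measureReal_nonempty_le [IsProbabilityMeasure P] [IsProbabilityMeasure P'] (hprod : HasProductIntensity P P' 𝔪 z 𝒞)
    (h𝔪 : Measurable 𝔪) (hz : IsNucleus z) {G : Set (Body d)} (hG : MeasurableSet G)
    (hinv : ∀ C x, shift x C ∈ G ↔ C ∈ G) {S : Set (E d)} (hS : MeasurableSet S)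
    (hfin : volume S ≠ ∞) :
    P.real {ω | (cellsIn z (𝔪 ω) S ∩ G).Nonempty} ≤ volume.real S * P'.real (𝒞 ⁻¹' G) := by
  have h : P {ω | (cellsIn z (𝔪 ω) S ∩ G).Nonempty} ≤ volume S * P' (𝒞 ⁻¹' G) := by
    rw [← hprod G hG hinv S hS]
    have := mul_meas_ge_le_lintegral (μ := P) ((measurable_encard_cellsIn hz hS hG).comp h𝔪) 1
    rw [one_mul] at this
    refine le_trans (measure_mono fun ω hω => ?_) this
    have h1 : 1 ≤ (cellsIn z (𝔪 ω) S ∩ G).encard := one_le_encard_iff_nonempty.2 hω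
    have h2 := ENat.toENNReal_mono h1
    rw [ENat.toENNReal_one] at h2
    exact h2
  simp only [Measure.real]
  rw [← ENNReal.toReal_mul]
  exact ENNReal.toReal_mono (ENNReal.mul_ne_top hfin (measure_ne_top _ _)) h

/-- If the maximum exceeds u on T but not on S, some exceeding cell has its nucleus in T \ S. -/
theorem probLe_le_add_of_subset [IsProbabilityMeasure P] [IsProbabilityMeasure P'] (hprod : HasProductIntensity P P' 𝔪 z 𝒞)
    (h𝔪 : Measurable 𝔪) (hz : IsNucleus z) (hf : Measurable f)
    (hfinv : ∀ C x, f (shift x C) = f C) {S T : Set (E d)} (hS : MeasurableSet S)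
    (hT : MeasurableSet T) (hST : S ⊆ T) (hfin : volume T ≠ ∞) (u : ℝ) :
    probLe P 𝔪 z f S u ≤
      probLe P 𝔪 z f T u +
        (volume.real T - volume.real S) * P'.real {ω' | u < f (𝒞 ω')} := by
  have hG : MeasurableSet {C | u < f C} := measurableSet_lt measurable_const hf
  have h := measureReal_nonempty_le hprod h𝔪 hz hG (fun C x => by simp [hfinv]) (hT.diff hS)
    (measure_ne_top_of_subset sdiff_subset hfin)
  rw [measureReal_sdiff hST hS hfin] at h
  refine le_trans ?_ (add_le_add le_rfl h)
  refine le_trans (measureReal_mono ?_) (measureReal_union_le _ _)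
  intro ω hω
  simp only [mem_ofPred_eq, maxOver_le_iff, mem_union] at hω ⊢
  by_contra! hcon
  obtain ⟨⟨C, hC, huC⟩, h2⟩ := hcon
  have : C ∈ cellsIn z (𝔪 ω) (T \ S) ∩ {C | u < f C} :=
    ⟨⟨hC.1, hC.2, fun hCS => huC.not_ge (hω C ⟨hC.1, hCS⟩)⟩, huC⟩
  rw [h2] at this
  exact this

/-- If the maximum is at most v but exceeds u, some cell has its value in (u, v]. -/
theorem probLe_le_add_of_le [IsProbabilityMeasure P] [IsProbabilityMeasure P'] (hprod : HasProductIntensity P P' 𝔪 z 𝒞)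
    (h𝔪 : Measurable 𝔪) (hz : IsNucleus z) (hf : Measurable f) (h𝒞 : Measurable 𝒞)
    (hfinv : ∀ C x, f (shift x C) = f C) {S : Set (E d)} (hS : MeasurableSet S)
    (hfin : volume S ≠ ∞) {u v : ℝ} (huv : u ≤ v) :
    probLe P 𝔪 z f S v ≤ probLe P 𝔪 z f S u +
      volume.real S * (P'.real {ω' | u < f (𝒞 ω')} - P'.real {ω' | v < f (𝒞 ω')}) := by
  have hG : MeasurableSet {C | u < f C ∧ f C ≤ v} :=
    (measurableSet_lt measurable_const hf).inter (measurableSet_le hf measurable_const)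
  have h := measureReal_nonempty_le hprod h𝔪 hz hG (fun C x => by simp [hfinv]) hS hfin
  have e : 𝒞 ⁻¹' {C | u < f C ∧ f C ≤ v} = {ω' | u < f (𝒞 ω')} \ {ω' | v < f (𝒞 ω')} := by
    ext ω'
    simp
  have hsub : {ω' | v < f (𝒞 ω')} ⊆ {ω' | u < f (𝒞 ω')} := fun ω' h => lt_of_le_of_lt huv h
  have hm : MeasurableSet {ω' | v < f (𝒞 ω')} := measurableSet_lt measurable_const (hf.comp h𝒞)
  rw [e, measureReal_sdiff hsub hm] at h
  refine le_trans ?_ (add_le_add le_rfl h)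
  refine le_trans (measureReal_mono ?_) (measureReal_union_le _ _)
  intro ω hω
  simp only [mem_ofPred_eq, maxOver_le_iff, mem_union] at hω ⊢
  by_contra! hcon
  obtain ⟨⟨C, hC, huC⟩, h2⟩ := hcon
  have : C ∈ cellsIn z (𝔪 ω) S ∩ {C | u < f C ∧ f C ≤ v} := ⟨hC, huC, hω C hC⟩
  rw [h2] at this
  exact this

theorem abs_probLe_sub_le [IsProbabilityMeasure P] [IsProbabilityMeasure P'] (hprod : HasProductIntensity P P' 𝔪 z 𝒞)
    (h𝔪 : Measurable 𝔪) (hz : IsNucleus z) (hf : Measurable f) (h𝒞 : Measurable 𝒞)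
    (hfinv : ∀ C x, f (shift x C) = f C) {S : Set (E d)} (hS : MeasurableSet S)
    (hfin : volume S ≠ ∞) (u v : ℝ) :
    |probLe P 𝔪 z f S u - probLe P 𝔪 z f S v| ≤
      |volume.real S * P'.real {ω' | u < f (𝒞 ω')} -
        volume.real S * P'.real {ω' | v < f (𝒞 ω')}| := by
  wlog huv : u ≤ v generalizing u v
  · rw [abs_sub_comm, abs_sub_comm (_ * _)]
    exact this v u (le_of_not_ge huv)
  have h1 := probLe_le_add_of_le hprod h𝔪 hz hf h𝒞 hfinv hS hfin huv
  have h2 : probLe P 𝔪 z f S u ≤ probLe P 𝔪 z f S v := probLe_mono huv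
  rw [abs_of_nonpos (by linarith), ← mul_sub]
  refine le_trans ?_ (le_abs_self _)
  linarith

/-- This compares S with the empty region, over which the maximum is -∞. -/
theorem one_sub_le_probLe [IsProbabilityMeasure P] [IsProbabilityMeasure P'] (hprod : HasProductIntensity P P' 𝔪 z 𝒞)
    (h𝔪 : Measurable 𝔪) (hz : IsNucleus z) (hf : Measurable f)
    (hfinv : ∀ C x, f (shift x C) = f C) {S : Set (E d)} (hS : MeasurableSet S)
    (hfin : volume S ≠ ∞) (u : ℝ) :
    1 - volume.real S * P'.real {ω' | u < f (𝒞 ω')} ≤ probLe P 𝔪 z f S u := by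
  have h := probLe_le_add_of_subset hprod h𝔪 hz hf hfinv MeasurableSet.empty hS
    (empty_subset S) hfin u
  have h0 : probLe P 𝔪 z f (∅ : Set (E d)) u = 1 := by
    simp [probLe, maxOver, cellsIn]
  rw [h0, measureReal_empty, sub_zero] at h
  linarith

end

/-! ### Conditioning and products -/

/-- With Q the conditional law, Q(F) - P(F) = Q(F)(1 - P(A)) - P(F \ A), a difference of two numbers
in [0, 1 - P(A)]. -/
theorem abs_cond_sub_le {Ω : Type*} [MeasurableSpace Ω] {P : Measure Ω} [IsProbabilityMeasure P]
    {A : Set Ω} (hA : MeasurableSet A) (hA0 : P A ≠ 0) (F : Set Ω) :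
    |(ProbabilityTheory.cond P A).real F - P.real F| ≤ 1 - P.real A := by
  have hpos : 0 < P.real A := ENNReal.toReal_pos hA0 (measure_ne_top P A)
  have h1 : (ProbabilityTheory.cond P A).real F * P.real A = P.real (A ∩ F) := by
    simp only [Measure.real] at hpos ⊢
    rw [cond_apply hA, ENNReal.toReal_mul, ENNReal.toReal_inv]
    field_simp
  have h2 : P.real (A ∩ F) + P.real (F \ A) = P.real F := by
    rw [inter_comm]
    exact measureReal_inter_add_sdiff hA
  have h3 : P.real (F \ A) ≤ 1 - P.real A := by
    rw [← probReal_compl_eq_one_sub hA]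
    exact measureReal_mono (fun x hx => hx.2)
  have h4 : 0 ≤ P.real (F \ A) := measureReal_nonneg
  have hle : P.real A ≤ 1 := measureReal_le_one
  have hprob : IsProbabilityMeasure (ProbabilityTheory.cond P A) := cond_isProbabilityMeasure hA0
  have h5 : (ProbabilityTheory.cond P A).real F ≤ 1 := measureReal_le_one
  have h6 : 0 ≤ (ProbabilityTheory.cond P A).real F := measureReal_nonneg
  rw [abs_le]
  constructor <;> nlinarith

theorem abs_prod_sub_prod_le {ι : Type*} (s : Finset ι) (x y : ι → ℝ)
    (hx0 : ∀ i ∈ s, 0 ≤ x i) (hx1 : ∀ i ∈ s, x i ≤ 1) (hy0 : ∀ i ∈ s, 0 ≤ y i)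
    (hy1 : ∀ i ∈ s, y i ≤ 1) :
    |∏ i ∈ s, x i - ∏ i ∈ s, y i| ≤ ∑ i ∈ s, |x i - y i| := by
  classical
  induction s using Finset.induction_on with
  | empty => simp
  | insert a s ha ih =>
    rw [Finset.prod_insert ha, Finset.prod_insert ha, Finset.sum_insert ha]
    have ih' := ih (fun i hi => hx0 i (Finset.mem_insert_of_mem hi))
      (fun i hi => hx1 i (Finset.mem_insert_of_mem hi))
      (fun i hi => hy0 i (Finset.mem_insert_of_mem hi))
      (fun i hi => hy1 i (Finset.mem_insert_of_mem hi))
    have hX : |∏ i ∈ s, x i| ≤ 1 := by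
      rw [abs_of_nonneg (Finset.prod_nonneg fun i hi => hx0 i (Finset.mem_insert_of_mem hi))]
      exact Finset.prod_le_one (fun i hi => hx0 i (Finset.mem_insert_of_mem hi))
        (fun i hi => hx1 i (Finset.mem_insert_of_mem hi))
    have hy : |y a| ≤ 1 := by
      rw [abs_of_nonneg (hy0 a (Finset.mem_insert_self a s))]
      exact hy1 a (Finset.mem_insert_self a s)
    have e : x a * ∏ i ∈ s, x i - y a * ∏ i ∈ s, y i =
        (x a - y a) * ∏ i ∈ s, x i + y a * (∏ i ∈ s, x i - ∏ i ∈ s, y i) := by ring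
    rw [e]
    refine (abs_add_le _ _).trans (add_le_add ?_ ?_)
    · rw [abs_mul]
      exact mul_le_of_le_one_right (abs_nonneg _) hX
    · rw [abs_mul]
      exact (mul_le_of_le_one_left (abs_nonneg _) hy).trans ih'

/-! ### Cubes and their subdivisions -/

theorem isClosed_cube {d : ℕ} (a : E d) (s : ℝ) : IsClosed (cube a s) := by
  have h : cube a s = ⋂ r, ({x : E d | a r ≤ x r} ∩ {x : E d | x r ≤ a r + s}) := by
    ext x
    simp [cube]
  rw [h]
  refine isClosed_iInter fun r => IsClosed.inter ?_ ?_
  · exact isClosed_le continuous_const (by fun_prop)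
  · exact isClosed_le (by fun_prop) continuous_const

theorem volume_cube {d : ℕ} (a : E d) (s : ℝ) : volume (cube a s) = ENNReal.ofReal s ^ d := by
  have h : cube a s = (WithLp.ofLp : E d → Fin d → ℝ) ⁻¹'
      Icc (fun r => a r) (fun r => a r + s) := by
    ext x
    simp [cube, Pi.le_def, forall_and]
  rw [h, (PiLp.volume_preserving_ofLp (Fin d)).measure_preimage measurableSet_Icc.nullMeasurableSet,
    Real.volume_Icc_pi]
  simp

theorem volume_smul_cube {d : ℕ} {c : ℝ} (hc : 0 ≤ c) (a : E d) (s : ℝ) :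
    volume (c • cube a s) = ENNReal.ofReal (c ^ d) * ENNReal.ofReal s ^ d := by
  rw [Measure.addHaar_smul, volume_cube, finrank_euclideanSpace_fin,
    abs_of_nonneg (pow_nonneg hc d)]

theorem volume_smul_cube_ne_top {d : ℕ} {c : ℝ} (hc : 0 ≤ c) (a : E d) (s : ℝ) :
    volume (c • cube a s) ≠ ∞ := by
  rw [volume_smul_cube hc]
  exact ENNReal.mul_ne_top ENNReal.ofReal_ne_top (ENNReal.pow_ne_top ENNReal.ofReal_ne_top)

theorem volumeReal_smul_cube {d : ℕ} {c s : ℝ} (hc : 0 ≤ c) (hs : 0 ≤ s) (a : E d) :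
    volume.real (c • cube a s) = c ^ d * s ^ d := by
  rw [Measure.real, volume_smul_cube hc, ENNReal.toReal_mul, ENNReal.toReal_pow,
    ENNReal.toReal_ofReal (pow_nonneg hc d), ENNReal.toReal_ofReal hs]

theorem measurableSet_smul_cube {d : ℕ} {c : ℝ} (hc : c ≠ 0) (a : E d) (s : ℝ) :
    MeasurableSet (c • cube a s) :=
  ((isClosed_cube a s).smul_of_ne_zero hc).measurableSet

theorem smul_cube_eq_preimage {d : ℕ} {c : ℝ} (hc : c ≠ 0) (a : E d) (s : ℝ) :
    c • cube a s = (fun y => y + -(c • a)) ⁻¹' (c • cube 0 s) := by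
  ext y
  rw [mem_preimage, mem_smul_set_iff_inv_smul_mem₀ hc, mem_smul_set_iff_inv_smul_mem₀ hc,
    smul_add, smul_neg, inv_smul_smul₀ hc]
  simp only [cube, mem_ofPred_eq, PiLp.add_apply, PiLp.neg_apply, PiLp.zero_apply]
  refine forall_congr' fun r => and_congr ?_ ?_ <;> constructor <;> intro h <;> linarith

theorem smul_cube_zero {d : ℕ} {c t : ℝ} (ht : 0 < t) :
    (c * t) • cube (0 : E d) 1 = c • cube (0 : E d) t := by
  rw [mul_smul]
  congr 1
  ext y
  rw [mem_smul_set_iff_inv_smul_mem₀ ht.ne']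
  simp only [cube, mem_ofPred_eq, PiLp.smul_apply, PiLp.zero_apply, smul_eq_mul, zero_add]
  refine forall_congr' fun r => and_congr ?_ ?_
  · rw [mul_nonneg_iff_of_pos_left (inv_pos.2 ht)]
  · rw [inv_mul_le_iff₀ ht, mul_one]

theorem rpow_inv_pow {d : ℕ} (hd : 1 ≤ d) {ρ : ℝ} (hρ : 0 ≤ ρ) :
    (ρ ^ ((1 : ℝ) / d)) ^ d = ρ := by
  rw [one_div]
  exact Real.rpow_inv_natCast_pow hρ (by omega)

theorem measurableSet_window {d : ℕ} {ρ : ℝ} (hρ : 0 < ρ) : MeasurableSet (window d ρ) :=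
  measurableSet_smul_cube (Real.rpow_pos_of_pos hρ _).ne' _ _

theorem volume_window_ne_top {d : ℕ} {ρ : ℝ} (hρ : 0 ≤ ρ) : volume (window d ρ) ≠ ∞ :=
  volume_smul_cube_ne_top (Real.rpow_nonneg hρ _) _ _

theorem volumeReal_window {d : ℕ} (hd : 1 ≤ d) {ρ : ℝ} (hρ : 0 ≤ ρ) :
    volume.real (window d ρ) = ρ := by
  rw [window, volumeReal_smul_cube (Real.rpow_nonneg hρ _) zero_le_one, rpow_inv_pow hd hρ]
  simp

theorem window_div {d k : ℕ} (hd : 1 ≤ d) (hk : 0 < k) {ρ : ℝ} (hρ : 0 ≤ ρ) :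
    window d (ρ / (k : ℝ) ^ d) = (ρ ^ ((1 : ℝ) / d)) • cube (0 : E d) (1 / k) := by
  have hk' : (0 : ℝ) < k := by exact_mod_cast hk
  rw [← smul_cube_zero (by positivity), window, Real.div_rpow hρ (by positivity), one_div (d : ℝ),
    Real.pow_rpow_inv_natCast hk'.le (by omega), mul_one_div]

/-- The cube of index `j` in the subdivision of `[0,1]^d` into `k^d` cubes, shrunk by `ε`. -/
def block {d : ℕ} (k : ℕ) (ε : ℝ) (j : Fin d → Fin k) : Set (E d) :=
  cube (WithLp.toLp 2 fun r => ((j r : ℕ) : ℝ) / k + ε) (1 / k - 2 * ε)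

theorem mem_block {d k : ℕ} {ε : ℝ} {j : Fin d → Fin k} {x : E d} :
    x ∈ block k ε j ↔
      ∀ r, ((j r : ℕ) : ℝ) / k + ε ≤ x r ∧ x r ≤ (((j r : ℕ) : ℝ) + 1) / k - ε := by
  simp only [block, cube, mem_ofPred_eq]
  refine forall_congr' fun r => and_congr Iff.rfl ?_
  rw [add_div]
  constructor <;> intro h <;> linarith

theorem block_subset_block_zero {d k : ℕ} {ε : ℝ} (hε : 0 ≤ ε) (j : Fin d → Fin k) :
    block k ε j ⊆ block k 0 j := by
  intro x hx
  rw [mem_block] at hx ⊢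
  exact fun r => ⟨by linarith [(hx r).1], by linarith [(hx r).2]⟩

theorem div_add_one_le_one {k : ℕ} (j : Fin k) : (((j : ℕ) : ℝ) + 1) / k ≤ 1 := by
  have hk : (0 : ℝ) < k := by exact_mod_cast j.pos
  rw [div_le_one hk]
  exact_mod_cast j.isLt

theorem block_zero_subset {d k : ℕ} (j : Fin d → Fin k) : block k 0 j ⊆ cube (0 : E d) 1 := by
  intro x hx r
  have h := mem_block.1 hx r
  have h1 := div_add_one_le_one (j r)
  have h2 : (0 : ℝ) ≤ ((j r : ℕ) : ℝ) / k := by positivity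
  simp only [PiLp.zero_apply]
  constructor <;> linarith [h.1, h.2]

theorem exists_fin_div_le {k : ℕ} (hk : 0 < k) {x : ℝ} (h0 : 0 ≤ x) (h1 : x ≤ 1) :
    ∃ j : Fin k, ((j : ℕ) : ℝ) / k ≤ x ∧ x ≤ (((j : ℕ) : ℝ) + 1) / k := by
  have hk' : (0 : ℝ) < k := by exact_mod_cast hk
  rcases h1.lt_or_eq with h1 | rfl
  · have hlt : ⌊(k : ℝ) * x⌋₊ < k := by
      rw [Nat.floor_lt (by positivity)]
      nlinarith
    refine ⟨⟨⌊(k : ℝ) * x⌋₊, hlt⟩, ?_, ?_⟩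
    · rw [div_le_iff₀ hk', mul_comm x]
      exact Nat.floor_le (by positivity)
    · rw [le_div_iff₀ hk', mul_comm x]
      exact (Nat.lt_floor_add_one _).le
  -- At x = 1 the floor would give the index k, which is out of range; the last closed interval
  -- contains this endpoint.
  · refine ⟨⟨k - 1, by omega⟩, ?_, ?_⟩
    · rw [div_le_one hk']
      exact_mod_cast Nat.sub_le k 1
    · rw [le_div_iff₀ hk', one_mul]
      have : k ≤ k - 1 + 1 := by omega
      exact_mod_cast this

theorem cube_subset_iUnion_block {d k : ℕ} (hk : 0 < k) :
    cube (0 : E d) 1 ⊆ ⋃ j, block k 0 j := by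
  intro x hx
  have h : ∀ r, ∃ j : Fin k, ((j : ℕ) : ℝ) / k ≤ x r ∧ x r ≤ (((j : ℕ) : ℝ) + 1) / k := by
    intro r
    have := hx r
    simp only [PiLp.zero_apply, zero_add] at this
    exact exists_fin_div_le hk this.1 this.2
  choose j hj using h
  refine mem_iUnion.2 ⟨j, mem_block.2 fun r => ?_⟩
  simpa using hj r

/-- The sub-cubes of index `i` of `∏_r [a_r, a_r + s]` contained in the block of index `j`, at
distance at least `R` sub-cubes from its upper faces. -/
def innerIndices {d : ℕ} (a : E d) (s : ℝ) (n k R : ℕ) (j : Fin d → Fin k) :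
    Set (Fin d → Fin n) :=
  {i | ∀ r, ((j r : ℕ) : ℝ) / k ≤ a r + s / n * ((i r : ℕ) : ℝ) ∧
    a r + s / n * (((i r : ℕ) : ℝ) + 1 + R) ≤ (((j r : ℕ) : ℝ) + 1) / k}

/-- A margin at the upper faces alone suffices: in a coordinate where the two blocks differ, the
lower block's margin of R sub-cubes separates the indices by at least R + 1. -/
theorem lt_indexDist_of_innerIndices {d : ℕ} {a : E d} {s : ℝ} (hs : 0 < s) {n k R : ℕ}
    {j j' : Fin d → Fin k} (hjj' : j ≠ j') {i i' : Fin d → Fin n}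
    (hi : i ∈ innerIndices a s n k R j) (hi' : i' ∈ innerIndices a s n k R j') :
    R < indexDist i i' := by
  have key : ∀ {j j' : Fin d → Fin k} {i i' : Fin d → Fin n} {r : Fin d},
      i ∈ innerIndices a s n k R j → i' ∈ innerIndices a s n k R j' → j r < j' r →
      (i r : ℕ) + 1 + R ≤ i' r := by
    intro j j' i i' r hi hi' h
    have hn : (0 : ℝ) < n := by exact_mod_cast (i r).pos
    have h1 := (hi r).2
    have h2 := (hi' r).1
    have h3 : (((j r : ℕ) : ℝ) + 1) / k ≤ ((j' r : ℕ) : ℝ) / k := by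
      gcongr
      exact_mod_cast h
    have h4 : s / n * (((i r : ℕ) : ℝ) + 1 + R) ≤ s / n * ((i' r : ℕ) : ℝ) := by linarith
    have h5 := le_of_mul_le_mul_left h4 (by positivity)
    exact_mod_cast h5
  obtain ⟨r, hr⟩ := Function.ne_iff.1 hjj'
  have hle : ((((i r : ℕ) : ℤ) - ((i' r : ℕ) : ℤ)).natAbs) ≤ indexDist i i' :=
    Finset.le_sup (f := fun r => (((i r : ℕ) : ℤ) - ((i' r : ℕ) : ℤ)).natAbs) (Finset.mem_univ r)
  rcases lt_or_gt_of_ne hr with h | h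
  · have := key hi hi' h
    omega
  · have := key hi' hi h
    omega

/-- A sub-cube through a point reaches at most one width s / n beyond it on either side. Trimming by
R + 1 widths therefore leaves room for the sub-cube itself and for the R further ones of the margin.
-/
theorem block_subset_iUnion {d : ℕ} {a : E d} {s : ℝ} (hs : 0 < s)
    (ha : ∀ r, a r ≤ 0 ∧ 1 ≤ a r + s) {n k R : ℕ} (hn : 0 < n) (j : Fin d → Fin k) :
    block k ((R + 1) * (s / n)) j ⊆ ⋃ i ∈ innerIndices a s n k R j,
      cube (WithLp.toLp 2 fun r => a r + (s / n) * ((i r : ℕ) : ℝ)) (s / n) := by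
  intro x hx
  rw [mem_block] at hx
  have hn' : (0 : ℝ) < n := by exact_mod_cast hn
  have hδ : 0 < s / n := by positivity
  set δ := s / n with hδdef
  have hsn : δ * n = s := by rw [hδdef]; field_simp
  have hR : (0 : ℝ) ≤ R * δ := by positivity
  have hi : ∀ r, ∃ i : Fin n, a r + δ * ((i : ℕ) : ℝ) ≤ x r ∧
      x r ≤ a r + δ * (((i : ℕ) : ℝ) + 1) ∧ x r - δ < a r + δ * ((i : ℕ) : ℝ) := by
    intro r
    have hj0 : (0 : ℝ) ≤ ((j r : ℕ) : ℝ) / k := by positivity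
    have hj1 := div_add_one_le_one (j r)
    have h1 := (hx r).1
    have h2 := (hx r).2
    have hy0 : 0 ≤ (x r - a r) / δ := by
      refine div_nonneg ?_ hδ.le
      nlinarith [(ha r).1]
    have hle := Nat.floor_le hy0
    have hlt := Nat.lt_floor_add_one ((x r - a r) / δ)
    rw [le_div_iff₀ hδ] at hle
    rw [div_lt_iff₀ hδ] at hlt
    -- The trimming keeps x r strictly below 1 ≤ a r + s, so the floor never reaches n.
    have hin : ⌊(x r - a r) / δ⌋₊ < n := by
      rw [Nat.floor_lt hy0, div_lt_iff₀ hδ]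
      nlinarith [(ha r).2]
    exact ⟨⟨_, hin⟩, by simp only; linarith, by simp only; linarith, by simp only; linarith⟩
  choose i hi using hi
  refine mem_iUnion₂.2 ⟨i, fun r => ⟨?_, ?_⟩, fun r => ⟨?_, ?_⟩⟩
  · nlinarith [(hi r).2.2, (hx r).1]
  · nlinarith [(hi r).1, (hx r).2]
  · exact (hi r).1
  · have := (hi r).2.1
    simp only
    linarith

theorem cube_subset_block {d : ℕ} {a : E d} {s : ℝ} (hs : 0 < s) {n k R : ℕ}
    {j : Fin d → Fin k} {i : Fin d → Fin n} (hi : i ∈ innerIndices a s n k R j) :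
    cube (WithLp.toLp 2 fun r => a r + (s / n) * ((i r : ℕ) : ℝ)) (s / n) ⊆ block k 0 j := by
  intro x hx
  rw [mem_block]
  intro r
  have h := hx r
  have h1 := hi r
  simp only at h
  have h2 : 0 ≤ s / n * R := by positivity
  constructor
  · linarith [h.1, h1.1]
  · linarith [h.2, h1.2]

/-! ### Approximate independence of the maxima over the blocks -/

/-- Independence of pairs of index sets is enough: blocks are added one at a time, each independent
of the union of the previous ones. -/
theorem measureReal_biInter_eq_prod {Ω ι κ : Type*} [MeasurableSpace Ω]
    {Q : Measure Ω} [IsProbabilityMeasure Q] {m : Set κ → MeasurableSpace Ω} (hm : Monotone m)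
    {I : ι → Set κ} {F : ι → Set Ω} (hF : ∀ j, MeasurableSet[m (I j)] (F j))
    (T : Finset ι)
    (hind : ∀ (S : Finset ι) (j : ι), j ∉ S → Indep (m (⋃ i ∈ S, I i)) (m (I j)) Q) :
    Q.real (⋂ j ∈ T, F j) = ∏ j ∈ T, Q.real (F j) := by
  classical
  induction T using Finset.induction_on with
  | empty => simp
  | insert j T hj ih =>
    have h1 : MeasurableSet[m (⋃ i ∈ T, I i)] (⋂ i ∈ T, F i) :=
      MeasurableSet.biInter (Finset.countable_toSet T) fun i hi =>
        hm (subset_biUnion_of_mem (u := I) (show i ∈ (T : Set ι) from hi)) _ (hF i)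
    have h2 := (Indep_iff _ _ _).1 (hind T j hj) _ _ h1 (hF j)
    rw [Finset.prod_insert hj, ← ih, Finset.set_biInter_insert, inter_comm, mul_comm]
    simp only [Measure.real]
    rw [h2, ENNReal.toReal_mul]

theorem sigmaMax_mono {d : ℕ} {Ω : Type*} (𝔪 : Ω → Tessellation d)
    (z : Tessellation d → Body d → E d) (f : Body d → ℝ) (a : E d) (s ρ : ℝ) (n : ℕ) :
    Monotone (sigmaMax 𝔪 z f a s ρ n) :=
  fun _ _ h => biSup_mono fun _ hi => h hi

theorem measurableSet_sigmaMax {d : ℕ} {Ω : Type*} (𝔪 : Ω → Tessellation d)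
    (z : Tessellation d → Body d → E d) (f : Body d → ℝ) (a : E d) (s ρ : ℝ) (n : ℕ)
    (I : Set (Fin d → Fin n)) (u : ℝ) :
    MeasurableSet[sigmaMax 𝔪 z f a s ρ n I]
      {ω | maxOver z f (⋃ i ∈ I, subCube a s ρ n i ∩ window d ρ) (𝔪 ω) ≤ (u : EReal)} := by
  have h : {ω | maxOver z f (⋃ i ∈ I, subCube a s ρ n i ∩ window d ρ) (𝔪 ω) ≤ (u : EReal)} =
      ⋂ i ∈ I, (fun ω => maxOver z f (subCube a s ρ n i ∩ window d ρ) (𝔪 ω)) ⁻¹' Iic (u : EReal) := by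
    ext ω
    simp [maxOver_iUnion_le_iff]
  rw [h]
  refine MeasurableSet.biInter (to_countable I) fun i hi => ?_
  exact le_iSup₂ (f := fun i (_ : i ∈ I) => MeasurableSpace.comap
    (fun ω => maxOver z f (subCube a s ρ n i ∩ window d ρ) (𝔪 ω)) inferInstance) i hi _
    ⟨_, measurableSet_Iic, rfl⟩

section

variable {d : ℕ} {Ω Ω' : Type*} [MeasurableSpace Ω] [MeasurableSpace Ω']
  {P : Measure Ω} {P' : Measure Ω'}
  {𝔪 : Ω → Tessellation d} {z : Tessellation d → Body d → E d} {𝒞 : Ω' → Body d} {f : Body d → ℝ}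

theorem probLe_block (hd : 1 ≤ d) (h𝔪 : Measurable 𝔪) (hstat : IsStationary P 𝔪)
    (hz : IsNucleus z) (hf : Measurable f) (hfinv : ∀ C x, f (shift x C) = f C)
    {k : ℕ} (hk : 0 < k) {ρ : ℝ} (hρ : 0 < ρ) (j : Fin d → Fin k) (u : ℝ) :
    probLe P 𝔪 z f ((ρ ^ ((1 : ℝ) / d)) • block k 0 j) u =
      probLe P 𝔪 z f (window d (ρ / (k : ℝ) ^ d)) u := by
  have hc : ρ ^ ((1 : ℝ) / d) ≠ 0 := (Real.rpow_pos_of_pos hρ _).ne'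
  rw [window_div hd hk hρ.le, block, smul_cube_eq_preimage hc,
    probLe_preimage_add h𝔪 hstat hz hf hfinv (measurableSet_smul_cube hc _ _)]
  simp

/-- Write η for the mean number of exceedances in the strip of one block and α = 1 - P(A). Restoring
the strips costs k^d η, conditioning the joint event costs α, and replacing each conditional factor
by q costs α + η. The total is 2 k^d η + (k^d + 1) α. -/
theorem abs_probLe_window_sub_pow_le [IsProbabilityMeasure P] [IsProbabilityMeasure P']
    (hd : 1 ≤ d) (hprod : HasProductIntensity P P' 𝔪 z 𝒞)
    (h𝔪 : Measurable 𝔪) (hstat : IsStationary P 𝔪)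
    (hz : IsNucleus z) (hf : Measurable f) (hfinv : ∀ C x, f (shift x C) = f C)
    {a : E d} {s : ℝ} (hs : 0 < s) (ha : ∀ r, a r ≤ 0 ∧ 1 ≤ a r + s)
    {n k R : ℕ} (hn : 0 < n) (hk : 0 < k) {ρ : ℝ} (hρ : 0 < ρ)
    {A : Set Ω} (hA : MeasurableSet A) (hA0 : P A ≠ 0)
    (hind : ∀ I J : Set (Fin d → Fin n), (∀ i ∈ I, ∀ j ∈ J, R < indexDist i j) →
      Indep (sigmaMax 𝔪 z f a s ρ n I) (sigmaMax 𝔪 z f a s ρ n J) (ProbabilityTheory.cond P A))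
    (hε : 2 * ((R + 1) * (s / n)) ≤ 1 / k) (u : ℝ) :
    |probLe P 𝔪 z f (window d ρ) u - probLe P 𝔪 z f (window d (ρ / (k : ℝ) ^ d)) u ^ (k ^ d)| ≤
      2 * (k : ℝ) ^ d * ((ρ * P'.real {ω' | u < f (𝒞 ω')}) *
        ((1 / k : ℝ) ^ d - (1 / k - 2 * ((R + 1) * (s / n))) ^ d)) +
      ((k : ℝ) ^ d + 1) * (1 - P.real A) := by
  classical
  have hQ : IsProbabilityMeasure (ProbabilityTheory.cond P A) := cond_isProbabilityMeasure hA0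
  set c := ρ ^ ((1 : ℝ) / d) with hcdef
  have hc : 0 < c := Real.rpow_pos_of_pos hρ _
  have hcd : c ^ d = ρ := rpow_inv_pow hd hρ.le
  set ε : ℝ := (R + 1) * (s / n) with hεdef
  have hε0 : 0 ≤ ε := by positivity
  set p := P'.real {ω' | u < f (𝒞 ω')}
  set η := ρ * p * ((1 / k : ℝ) ^ d - (1 / k - 2 * ε) ^ d) with hη
  set α := 1 - P.real A with hα
  set q := probLe P 𝔪 z f (window d (ρ / (k : ℝ) ^ d)) u with hq
  let I : (Fin d → Fin k) → Set (Fin d → Fin n) := innerIndices a s n k R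
  -- Intersecting with the window matches the maxima that generate `sigmaMax`. The trimmed block
  -- stays inside `U j`, because blocks lie in the window.
  let U : (Fin d → Fin k) → Set (E d) := fun j => ⋃ i ∈ I j, subCube a s ρ n i ∩ window d ρ
  let F : (Fin d → Fin k) → Set Ω := fun j => {ω | maxOver z f (U j) (𝔪 ω) ≤ (u : EReal)}
  let G : (Fin d → Fin k) → Set Ω :=
    fun j => {ω | maxOver z f (c • block k 0 j) (𝔪 ω) ≤ (u : EReal)}
  have hwin : window d ρ = c • cube 0 1 := rfl
  have hUmeas : ∀ j, MeasurableSet (U j) := fun j =>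
    MeasurableSet.biUnion (to_countable _) fun i _ =>
      (measurableSet_smul_cube hc.ne' _ _).inter (measurableSet_window hρ)
  have hFmeas : ∀ j, MeasurableSet (F j) := fun j =>
    measurableSet_maxOver_le' h𝔪 hz hf (hUmeas j) u
  have hbm : ∀ (δ : ℝ) (j : Fin d → Fin k), MeasurableSet (c • block k δ j) := fun δ j =>
    measurableSet_smul_cube hc.ne' _ _
  have hGmeas : ∀ j, MeasurableSet (G j) := fun j =>
    measurableSet_maxOver_le' h𝔪 hz hf (hbm 0 j) u
  have hUblock : ∀ j, U j ⊆ c • block k 0 j := fun j =>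
    iUnion₂_subset fun i hi => inter_subset_left.trans (smul_set_mono (cube_subset_block hs hi))
  have hblockU : ∀ j, c • block k ε j ⊆ U j := by
    intro j
    rintro _ ⟨x, hx, rfl⟩
    obtain ⟨i, hi, hxi⟩ := mem_iUnion₂.1 (block_subset_iUnion hs ha hn j hx)
    refine mem_iUnion₂.2 ⟨i, hi, smul_mem_smul_set hxi, ?_⟩
    exact smul_mem_smul_set (block_zero_subset j (block_subset_block_zero hε0 j hx))
  have hGq : ∀ j, P.real (G j) = q := fun j =>
    probLe_block hd h𝔪 hstat hz hf hfinv hk hρ j u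
  have hFlow : ∀ j, q ≤ P.real (F j) := fun j => (hGq j).symm.le.trans (probLe_anti (hUblock j))
  have hFup : ∀ j, P.real (F j) ≤ q + η := by
    intro j
    have h1 : P.real (F j) ≤ probLe P 𝔪 z f (c • block k ε j) u := probLe_anti (hblockU j)
    have h2 := probLe_le_add_of_subset hprod h𝔪 hz hf hfinv (hbm ε j) (hbm 0 j)
      (smul_set_mono (block_subset_block_zero hε0 j)) (volume_smul_cube_ne_top hc.le _ _) u
    have h3 : volume.real (c • block k 0 j : Set (E d)) = ρ * (1 / k : ℝ) ^ d := by
      rw [block, volumeReal_smul_cube hc.le (by simp), hcd]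
      simp
    have h4 : volume.real (c • block k ε j : Set (E d)) = ρ * (1 / k - 2 * ε) ^ d := by
      rw [block, volumeReal_smul_cube hc.le (by linarith), hcd]
    rw [h3, h4] at h2
    have h5 : probLe P 𝔪 z f (c • block k 0 j) u = q := hGq j
    rw [h5] at h2
    refine h1.trans (h2.trans (le_of_eq ?_))
    rw [hη]
    ring
  -- If no trimmed block has an exceedance but the window does, then for some block j the event `F
  -- j` holds and `G j` fails, which has probability at most η.
  have hcap : P.real (⋂ j, F j) ≤ probLe P 𝔪 z f (window d ρ) u + (k : ℝ) ^ d * η := by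
    have hsub : (⋂ j, F j) ⊆
        {ω | maxOver z f (window d ρ) (𝔪 ω) ≤ (u : EReal)} ∪ ⋃ j, (F j \ G j) := by
      intro ω hω
      rw [mem_iInter] at hω
      by_cases hG : ∀ j, ω ∈ G j
      · left
        have hsub : window d ρ ⊆ ⋃ j ∈ (univ : Set (Fin d → Fin k)), c • block k 0 j := by
          rw [hwin, biUnion_univ, ← smul_set_iUnion]
          exact smul_set_mono (cube_subset_iUnion_block hk)
        have h1 : maxOver z f (⋃ j ∈ (univ : Set (Fin d → Fin k)), c • block k 0 j) (𝔪 ω) ≤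
            (u : EReal) := maxOver_iUnion_le_iff.2 fun j _ => hG j
        rw [maxOver_le_iff] at h1
        exact maxOver_le_iff.2 fun C hC => h1 C (cellsIn_mono hsub _ hC)
      · right
        obtain ⟨j, hj⟩ := not_forall.1 hG
        exact mem_iUnion.2 ⟨j, hω j, hj⟩
    refine (measureReal_mono hsub).trans ((measureReal_union_le _ _).trans ?_)
    refine add_le_add le_rfl ((measureReal_iUnion_fintype_le _).trans ?_)
    have h1 : ∀ j, P.real (F j \ G j) ≤ η := by
      intro j
      have hGF : G j ⊆ F j := by
        intro ω hω
        have h1 : maxOver z f (c • block k 0 j) (𝔪 ω) ≤ (u : EReal) := hω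
        rw [maxOver_le_iff] at h1
        exact maxOver_le_iff.2 fun C hC => h1 C (cellsIn_mono (hUblock j) _ hC)
      rw [measureReal_sdiff hGF (hGmeas j), hGq j]
      linarith [hFup j]
    refine (Finset.sum_le_sum fun j _ => h1 j).trans (le_of_eq ?_)
    simp
  have hcap' : probLe P 𝔪 z f (window d ρ) u ≤ P.real (⋂ j, F j) := by
    refine measureReal_mono fun ω hω => mem_iInter.2 fun j => ?_
    have hUW : U j ⊆ window d ρ := iUnion₂_subset fun i _ => inter_subset_right
    have h1 : maxOver z f (window d ρ) (𝔪 ω) ≤ (u : EReal) := hω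
    rw [maxOver_le_iff] at h1
    exact maxOver_le_iff.2 fun C hC => h1 C (cellsIn_mono hUW _ hC)
  have hprodQ : (ProbabilityTheory.cond P A).real (⋂ j, F j) =
      ∏ j, (ProbabilityTheory.cond P A).real (F j) := by
    have h := measureReal_biInter_eq_prod (Q := ProbabilityTheory.cond P A)
      (sigmaMax_mono 𝔪 z f a s ρ n) (I := I) (F := F)
      (fun j => measurableSet_sigmaMax 𝔪 z f a s ρ n (I j) u) Finset.univ (by
        intro S j hj
        refine hind _ _ fun i hi i' hi' => ?_
        obtain ⟨l, hl, hil⟩ := mem_iUnion₂.1 hi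
        exact lt_indexDist_of_innerIndices hs (fun e => hj (by rwa [e] at hl)) hil hi')
    simpa using h
  have hcond := fun E => abs_cond_sub_le (P := P) hA hA0 E
  have h1 := hcond (⋂ j, F j)
  have h2 : |∏ j, (ProbabilityTheory.cond P A).real (F j) - q ^ (k ^ d)| ≤
      (k : ℝ) ^ d * (α + η) := by
    have e : q ^ (k ^ d) = ∏ _j : Fin d → Fin k, q := by simp
    rw [e]
    refine (abs_prod_sub_prod_le _ _ _ (fun _ _ => measureReal_nonneg)
      (fun _ _ => measureReal_le_one) (fun _ _ => probLe_nonneg)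
      (fun _ _ => probLe_le_one)).trans ?_
    have h3 : ∀ j, |(ProbabilityTheory.cond P A).real (F j) - q| ≤ α + η := by
      intro j
      have h4 := abs_le.1 (hcond (F j))
      rw [abs_le]
      constructor <;> linarith [h4.1, h4.2, hFlow j, hFup j]
    refine (Finset.sum_le_sum fun j _ => h3 j).trans (le_of_eq ?_)
    rw [Finset.sum_const, nsmul_eq_mul]
    simp
  rw [hprodQ] at h1
  rw [abs_le] at h1 h2 ⊢
  constructor <;> nlinarith [h1.1, h1.2, h2.1, h2.2]

end

/-! ### Upper and lower limits of functions with values in the unit interval -/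

theorem limsup_le_limsup_add {x y e : ℝ → ℝ} {c : ℝ} (hx : ∀ ρ, x ρ ∈ Icc (0 : ℝ) 1)
    (hy : ∀ ρ, y ρ ∈ Icc (0 : ℝ) 1) (he : Tendsto e atTop (𝓝 c))
    (h : ∀ᶠ ρ in atTop, x ρ ≤ y ρ + e ρ) : limsup x atTop ≤ limsup y atTop + c := by
  refine le_of_forall_pos_le_add fun δ hδ => ?_
  have h1 : ∀ᶠ ρ in atTop, y ρ < limsup y atTop + δ / 2 :=
    eventually_lt_of_limsup_lt (by linarith)
      (isBoundedUnder_of ⟨1, fun ρ => (hy ρ).2⟩)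
  have h2 : ∀ᶠ ρ in atTop, e ρ < c + δ / 2 := he.eventually_lt_const (by linarith)
  refine limsup_le_of_le (isBoundedUnder_of ⟨0, fun ρ => (hx ρ).1⟩).isCoboundedUnder_le ?_
  filter_upwards [h, h1, h2] with ρ a b c'
  linarith

theorem liminf_le_liminf_add {x y e : ℝ → ℝ} {c : ℝ} (hx : ∀ ρ, x ρ ∈ Icc (0 : ℝ) 1)
    (hy : ∀ ρ, y ρ ∈ Icc (0 : ℝ) 1) (he : Tendsto e atTop (𝓝 c))
    (h : ∀ᶠ ρ in atTop, x ρ ≤ y ρ + e ρ) : liminf x atTop ≤ liminf y atTop + c := by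
  refine le_of_forall_pos_le_add fun δ hδ => ?_
  have h1 : ∀ᶠ ρ in atTop, liminf x atTop - δ / 2 < x ρ :=
    eventually_lt_of_lt_liminf (by linarith)
      (isBoundedUnder_of ⟨0, fun ρ => (hx ρ).1⟩)
  have h2 : ∀ᶠ ρ in atTop, e ρ < c + δ / 2 := he.eventually_lt_const (by linarith)
  have h3 : liminf x atTop - c - δ ≤ liminf y atTop := by
    refine le_liminf_of_le (isBoundedUnder_of ⟨1, fun ρ => (hy ρ).2⟩).isCoboundedUnder_ge ?_
    filter_upwards [h, h1, h2] with ρ a b c'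
    linarith
  linarith

/-- Truncation at 0 makes the power monotone on all of ℝ, as is needed to exchange it with upper and
lower limits; on [0,1] it changes nothing. -/
theorem monotone_max_zero_pow (k : ℕ) : Monotone fun t : ℝ => max t 0 ^ k := fun _ _ h =>
  pow_le_pow_left₀ (le_max_right _ _) (max_le_max_right 0 h) k

/-- The properties of the upper and of the lower limit at infinity which are used below. -/
structure IsLimitFunctional (Λ : (ℝ → ℝ) → ℝ) : Prop where
  le_add : ∀ (x y e : ℝ → ℝ) (c : ℝ), (∀ ρ, x ρ ∈ Icc (0 : ℝ) 1) → (∀ ρ, y ρ ∈ Icc (0 : ℝ) 1) →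
    Tendsto e atTop (𝓝 c) → (∀ᶠ ρ in atTop, x ρ ≤ y ρ + e ρ) → Λ x ≤ Λ y + c
  const : ∀ c : ℝ, Λ (fun _ => c) = c
  pow : ∀ (x : ℝ → ℝ) (k : ℕ), (∀ ρ, x ρ ∈ Icc (0 : ℝ) 1) → Λ (fun ρ => x ρ ^ k) = max (Λ x) 0 ^ k
  comp_div : ∀ (x : ℝ → ℝ) (K : ℝ), 0 < K → Λ (fun ρ => x (ρ / K)) = Λ x

theorem isLimitFunctional_limsup : IsLimitFunctional fun x => limsup x atTop where
  le_add _ _ _ _ := limsup_le_limsup_add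
  const c := limsup_const c
  pow x k hx := by
    have h := (monotone_max_zero_pow k).map_limsup_of_continuousAt (F := atTop) x
      (by fun_prop) (isBoundedUnder_of ⟨1, fun ρ => (hx ρ).2⟩)
      (isBoundedUnder_of ⟨0, fun ρ => (hx ρ).1⟩).isCoboundedUnder_le
    rw [h]
    congr 1
    ext ρ
    simp [max_eq_left (hx ρ).1]
  comp_div x K hK := by
    change limsup (x ∘ fun ρ => ρ / K) atTop = _
    rw [limsup_comp, map_div_atTop_eq K hK]

theorem isLimitFunctional_liminf : IsLimitFunctional fun x => liminf x atTop where
  le_add _ _ _ _ := liminf_le_liminf_add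
  const c := liminf_const c
  pow x k hx := by
    have h := (monotone_max_zero_pow k).map_liminf_of_continuousAt (F := atTop) x
      (by fun_prop) (isBoundedUnder_of ⟨1, fun ρ => (hx ρ).2⟩).isCoboundedUnder_ge
      (isBoundedUnder_of ⟨0, fun ρ => (hx ρ).1⟩)
    rw [h]
    congr 1
    ext ρ
    simp [max_eq_left (hx ρ).1]
  comp_div x K hK := by
    change liminf (x ∘ fun ρ => ρ / K) atTop = _
    rw [liminf_comp, map_div_atTop_eq K hK]

/-! ### The functional equation -/

/-- Since exp(θτ) ≥ 1 + θτ, the hypothesis gives (1 - τ)(1 + θτ) ≤ 1, that is θ - 1 ≤ θτ for τ > 0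
when τ ≤ 1. If θ > 1, this fails at τ = (θ - 1) / (2θ). -/
theorem le_one_of_one_sub_le_exp {θ : ℝ} (h : ∀ τ : ℝ, 0 ≤ τ → 1 - τ ≤ Real.exp (-θ * τ)) :
    θ ≤ 1 := by
  by_contra! hθ
  have hθ0 : 0 < θ := by linarith
  set τ := (θ - 1) / (2 * θ) with hτ
  have hθτ : θ * τ = (θ - 1) / 2 := by
    rw [hτ]
    field_simp
  have hτ0 : 0 < τ := div_pos (by linarith) (by linarith)
  have hτ1 : τ < 1 := by
    rw [hτ, div_lt_one (by linarith)]
    linarith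
  have h1 := h τ hτ0.le
  have h2 := Real.add_one_le_exp (θ * τ)
  have h3 : Real.exp (-θ * τ) * Real.exp (θ * τ) = 1 := by
    rw [← Real.exp_add]
    simp
  have h4 : (1 - τ) * (θ * τ + 1) ≤ 1 :=
    (mul_le_mul h1 h2 (by nlinarith) (Real.exp_pos _).le).trans h3.le
  rw [hθτ] at h4
  nlinarith [mul_pos hτ0 (sub_pos.2 hθ)]

/-- The equation fixes ψ at the points (p/q)^d in terms of ψ(1), and the Lipschitz bound extends the
formula to all τ ≥ 0. -/
theorem exists_eq_exp_of_pow_eq {d : ℕ} (hd : 1 ≤ d) {ψ : ℝ → ℝ}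
    (h0 : ∀ τ, 0 ≤ τ → 0 ≤ ψ τ) (h1 : ∀ τ, 0 ≤ τ → ψ τ ≤ 1)
    (hlow : ∀ τ, 0 ≤ τ → 1 - τ ≤ ψ τ)
    (hlip : ∀ τ τ', 0 ≤ τ → 0 ≤ τ' → ψ τ ≤ ψ τ' + |τ - τ'|)
    (hpow : ∀ (k : ℕ), 0 < k → ∀ τ, 0 ≤ τ → ψ τ = ψ (τ / (k : ℝ) ^ d) ^ (k ^ d)) :
    ∃ θ : ℝ, 0 ≤ θ ∧ θ ≤ 1 ∧ ∀ τ, 0 ≤ τ → ψ τ = Real.exp (-θ * τ) := by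
  -- The bound 1 - τ is useless at τ = 1, so the equation with k = 2 moves to τ = 2^(-d), where it
  -- gives at least 1/2.
  have hpos : 0 < ψ 1 := by
    rw [hpow 2 two_pos 1 zero_le_one]
    refine pow_pos ?_ _
    have h2 : (2 : ℝ) ≤ 2 ^ d := le_self_pow₀ (by norm_num) (by omega)
    have h3 := hlow (1 / 2 ^ d) (by positivity)
    have h4 : (1 : ℝ) / 2 ^ d ≤ 1 / 2 := one_div_le_one_div_of_le two_pos h2
    push_cast
    linarith
  set θ := -Real.log (ψ 1) with hθ
  have hψ1 : ψ 1 = Real.exp (-θ) := by rw [hθ, neg_neg, Real.exp_log hpos]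
  have hθ0 : 0 ≤ θ := by
    have := Real.log_nonpos hpos.le (h1 1 zero_le_one)
    linarith
  have hψ0 : ψ 0 = 1 := le_antisymm (h1 0 le_rfl) (by simpa using hlow 0 le_rfl)
  have hnat : ∀ p : ℕ, ψ ((p : ℝ) ^ d) = Real.exp (-θ * (p : ℝ) ^ d) := by
    intro p
    rcases Nat.eq_zero_or_pos p with rfl | hp
    · simp [hψ0, zero_pow (show d ≠ 0 by omega)]
    · have hp' : ((p : ℝ) ^ d) ≠ 0 := by positivity
      rw [hpow p hp _ (by positivity), div_self hp', hψ1, ← Real.exp_nat_mul]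
      push_cast
      ring_nf
  have hdiv : ∀ p q : ℕ, 0 < q →
      ψ (((p : ℝ) / q) ^ d) = Real.exp (-θ * ((p : ℝ) / q) ^ d) := by
    intro p q hq
    have hq' : ((q : ℝ) ^ d) ≠ 0 := by positivity
    have h2 := hpow q hq ((p : ℝ) ^ d) (by positivity)
    rw [← div_pow, hnat p] at h2
    refine (pow_left_inj₀ (h0 _ (by positivity)) (Real.exp_pos _).le
      (pow_pos hq d).ne').1 ?_
    rw [← h2, ← Real.exp_nat_mul]
    congr 1
    push_cast
    rw [div_pow]
    field_simp
  have hcont : Continuous fun t : ℝ => ψ |t| := by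
    refine (LipschitzWith.of_le_add (f := fun t : ℝ => ψ |t|) fun x y => ?_).continuous
    refine (hlip _ _ (abs_nonneg x) (abs_nonneg y)).trans ?_
    rw [Real.dist_eq]
    exact add_le_add le_rfl (abs_abs_sub_abs_le_abs_sub x y)
  -- Only scalings by d-th powers are available; after the substitution τ = |t|^d the known points
  -- are the rational t, which are dense. The absolute values make both sides continuous functions
  -- on all of ℝ.
  have heq : (fun t : ℝ => ψ |(|t| ^ d)|) = fun t => Real.exp (-θ * |t| ^ d) := by
    refine Rat.denseRange_cast.equalizer (hcont.comp (by fun_prop)) (by fun_prop) ?_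
    ext q
    have hq : |(q : ℝ)| = (q.num.natAbs : ℝ) / (q.den : ℝ) := by
      rw [Rat.cast_def, abs_div, Nat.abs_cast, Nat.cast_natAbs, Int.cast_abs]
    simp only [Function.comp_apply, abs_pow, abs_abs, hq]
    exact hdiv _ _ q.den_pos
  have hall : ∀ τ, 0 ≤ τ → ψ τ = Real.exp (-θ * τ) := by
    intro τ hτ
    have h2 := congrFun heq (τ ^ ((d : ℝ)⁻¹))
    simp only [abs_of_nonneg (Real.rpow_nonneg hτ _)] at h2
    rwa [Real.rpow_inv_natCast_pow hτ (by omega), abs_of_nonneg hτ] at h2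
  exact ⟨θ, hθ0, le_one_of_one_sub_le_exp fun τ hτ => (hlow τ hτ).trans (hall τ hτ).le, hall⟩

theorem exists_limitFunctional_eq_exp {d : ℕ} (hd : 1 ≤ d) {Λ : (ℝ → ℝ) → ℝ}
    (hΛ : IsLimitFunctional Λ) {g : ℝ → ℝ → ℝ} (hg : ∀ τ ρ, g τ ρ ∈ Icc (0 : ℝ) 1)
    (hlow : ∀ τ, 0 ≤ τ → ∃ e : ℝ → ℝ, Tendsto e atTop (𝓝 τ) ∧ ∀ᶠ ρ in atTop, 1 ≤ g τ ρ + e ρ)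
    (hlip : ∀ τ τ', 0 ≤ τ → 0 ≤ τ' → ∃ e : ℝ → ℝ, Tendsto e atTop (𝓝 |τ - τ'|) ∧
      ∀ᶠ ρ in atTop, g τ ρ ≤ g τ' ρ + e ρ)
    (hpow : ∀ k : ℕ, 0 < k → ∀ τ, 0 ≤ τ → Tendsto
      (fun ρ => g τ ρ - g (τ / (k : ℝ) ^ d) (ρ / (k : ℝ) ^ d) ^ (k ^ d)) atTop (𝓝 0)) :
    ∃ θ : ℝ, 0 ≤ θ ∧ θ ≤ 1 ∧ ∀ τ, 0 ≤ τ → Λ (g τ) = Real.exp (-θ * τ) := by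
  have hnonneg : ∀ τ, 0 ≤ Λ (g τ) := by
    intro τ
    have h := hΛ.le_add (fun _ => 0) (g τ) (fun _ => 0) 0 (fun _ => by simp) (hg τ)
      tendsto_const_nhds (Eventually.of_forall fun ρ => by linarith [(hg τ ρ).1])
    rwa [hΛ.const, add_zero] at h
  refine exists_eq_exp_of_pow_eq hd (fun τ _ => hnonneg τ) (fun τ _ => ?_) (fun τ hτ => ?_)
    (fun τ τ' hτ hτ' => ?_) (fun k hk τ hτ => ?_)
  · have h := hΛ.le_add (g τ) (fun _ => 1) (fun _ => 0) 0 (hg τ) (fun _ => by simp)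
      tendsto_const_nhds (Eventually.of_forall fun ρ => by linarith [(hg τ ρ).2])
    rwa [hΛ.const, add_zero] at h
  · obtain ⟨e, he, hge⟩ := hlow τ hτ
    have h := hΛ.le_add (fun _ => 1) (g τ) e τ (fun _ => by simp) (hg τ) he hge
    rw [hΛ.const] at h
    linarith
  · obtain ⟨e, he, hge⟩ := hlip τ τ' hτ hτ'
    exact hΛ.le_add _ _ e _ (hg τ) (hg τ') he hge
  · have h := hpow k hk τ hτ
    have hy : ∀ ρ, g (τ / (k : ℝ) ^ d) (ρ / (k : ℝ) ^ d) ^ (k ^ d) ∈ Icc (0 : ℝ) 1 := fun ρ =>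
      ⟨pow_nonneg (hg _ _).1 _, pow_le_one₀ (hg _ _).1 (hg _ _).2⟩
    -- An o(1) difference, used in both directions, gives equality of the limits.
    have h2 := hΛ.le_add _ _ _ 0 (hg τ) hy h (Eventually.of_forall fun ρ => by linarith)
    have h3 := hΛ.le_add _ _ _ (-0) hy (hg τ) h.neg (Eventually.of_forall fun ρ => by linarith)
    have hk' : (0 : ℝ) < (k : ℝ) ^ d := by positivity
    have h4 := hΛ.pow (fun ρ => g (τ / (k : ℝ) ^ d) (ρ / (k : ℝ) ^ d)) (k ^ d) fun ρ => hg _ _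
    rw [hΛ.comp_div (g (τ / (k : ℝ) ^ d)) _ hk', max_eq_left (hnonneg _)] at h4
    rw [← h4]
    linarith

/-! ### The maxima over the windows -/

theorem abs_pow_sub_pow_le {x y : ℝ} (hx : x ∈ Icc (0 : ℝ) 1) (hy : y ∈ Icc (0 : ℝ) 1) (K : ℕ) :
    |x ^ K - y ^ K| ≤ K * |x - y| := by
  have h := abs_prod_sub_prod_le (Finset.range K) (fun _ => x) (fun _ => y)
    (fun _ _ => hx.1) (fun _ _ => hx.2) (fun _ _ => hy.1) (fun _ _ => hy.2)
  simpa using h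

theorem bounds_of_cube_subset {d : ℕ} {a : E d} {s : ℝ} (h : cube (0 : E d) 1 ⊆ cube a s)
    (r : Fin d) : a r ≤ 0 ∧ 1 ≤ a r + s := by
  have h0 := h (show (0 : E d) ∈ cube 0 1 by simp [cube]) r
  have h1 := h (show (WithLp.toLp 2 fun _ => 1 : E d) ∈ cube 0 1 by simp [cube]) r
  exact ⟨by simpa using h0.1, by simpa using h1.2⟩

section

variable {d : ℕ} {Ω Ω' : Type*} [MeasurableSpace Ω] [MeasurableSpace Ω']
  {P : Measure Ω} [IsProbabilityMeasure P] {P' : Measure Ω'} [IsProbabilityMeasure P']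
  {𝔪 : Ω → Tessellation d} {z : Tessellation d → Body d → E d} {𝒞 : Ω' → Body d} {f : Body d → ℝ}

/-- The relative width of the strips is of order 1 / n ρ and tends to 0, while the mean number of
exceedances in the window stays bounded. The threshold is still that of the large window. -/
theorem tendsto_probMaxLe_sub_pow (hd : 1 ≤ d) (hprod : HasProductIntensity P P' 𝔪 z 𝒞)
    (h𝔪 : Measurable 𝔪) (hstat : IsStationary P 𝔪)
    (hz : IsNucleus z) (hf : Measurable f) (hfinv : ∀ C x, f (shift x C) = f C)
    {a : E d} {s : ℝ} (hs : 0 < s) (ha : ∀ r, a r ≤ 0 ∧ 1 ≤ a r + s)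
    {n : ℝ → ℕ} (hn : Tendsto n atTop atTop) (hR : RDependent P 𝔪 z f a s n)
    {u : ℝ → ℝ} {τ : ℝ}
    (hu : Tendsto (fun ρ => ρ * P'.real {ω' | u ρ < f (𝒞 ω')}) atTop (𝓝 τ))
    {k : ℕ} (hk : 0 < k) :
    Tendsto (fun ρ => probMaxLe P 𝔪 z f ρ (u ρ) -
      probMaxLe P 𝔪 z f (ρ / (k : ℝ) ^ d) (u ρ) ^ (k ^ d)) atTop (𝓝 0) := by
  obtain ⟨R, A, hA, hPA, hind⟩ := hR
  have hPA' : Tendsto (fun ρ => P.real (A ρ)) atTop (𝓝 1) := by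
    have := (ENNReal.tendsto_toReal ENNReal.one_ne_top).comp hPA
    rwa [ENNReal.toReal_one] at this
  have hε : Tendsto (fun ρ => 2 * (((R : ℝ) + 1) * (s / (n ρ : ℝ)))) atTop (𝓝 0) := by
    have h1 : Tendsto (fun ρ => s / (n ρ : ℝ)) atTop (𝓝 0) :=
      tendsto_const_nhds.div_atTop (tendsto_natCast_atTop_atTop.comp hn)
    simpa using (h1.const_mul ((R : ℝ) + 1)).const_mul 2
  have hbound : Tendsto (fun ρ => 2 * (k : ℝ) ^ d * ((ρ * P'.real {ω' | u ρ < f (𝒞 ω')}) *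
        ((1 / k : ℝ) ^ d - (1 / k - 2 * (((R : ℝ) + 1) * (s / (n ρ : ℝ)))) ^ d)) +
      ((k : ℝ) ^ d + 1) * (1 - P.real (A ρ))) atTop (𝓝 0) := by
    have h1 : Tendsto (fun ρ => (1 / k : ℝ) ^ d -
        (1 / k - 2 * (((R : ℝ) + 1) * (s / (n ρ : ℝ)))) ^ d) atTop (𝓝 0) := by
      simpa using ((hε.const_sub (1 / k : ℝ)).pow d).const_sub ((1 / k : ℝ) ^ d)
    have h2 := ((hu.mul h1).const_mul (2 * (k : ℝ) ^ d)).add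
      ((hPA'.const_sub 1).const_mul ((k : ℝ) ^ d + 1))
    simpa using h2
  refine squeeze_zero_norm' ?_ hbound
  filter_upwards [hind, eventually_gt_atTop 0, hn.eventually_gt_atTop 0,
    hPA.eventually_const_lt zero_lt_one,
    hε.eventually_le_const (show (0 : ℝ) < 1 / k by positivity)] with ρ h1 hρ hnρ hA0 hερ
  exact abs_probLe_window_sub_pow_le hd hprod h𝔪 hstat hz hf hfinv hs ha hnρ hk hρ (hA ρ) hA0.ne'
    h1 hερ (u ρ)

theorem probMaxLe_mem_Icc (ρ t : ℝ) : probMaxLe P 𝔪 z f ρ t ∈ Icc (0 : ℝ) 1 :=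
  ⟨measureReal_nonneg, measureReal_le_one⟩

theorem abs_probMaxLe_sub_le (hd : 1 ≤ d) (hprod : HasProductIntensity P P' 𝔪 z 𝒞)
    (h𝔪 : Measurable 𝔪) (hz : IsNucleus z) (hf : Measurable f) (h𝒞 : Measurable 𝒞)
    (hfinv : ∀ C x, f (shift x C) = f C) {ρ : ℝ} (hρ : 0 < ρ) (u v : ℝ) :
    |probMaxLe P 𝔪 z f ρ u - probMaxLe P 𝔪 z f ρ v| ≤
      |ρ * P'.real {ω' | u < f (𝒞 ω')} - ρ * P'.real {ω' | v < f (𝒞 ω')}| := by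
  have h := abs_probLe_sub_le hprod h𝔪 hz hf h𝒞 hfinv (measurableSet_window hρ)
    (volume_window_ne_top hρ.le) u v
  rwa [volumeReal_window hd hρ.le] at h

theorem one_sub_le_probMaxLe (hd : 1 ≤ d) (hprod : HasProductIntensity P P' 𝔪 z 𝒞)
    (h𝔪 : Measurable 𝔪) (hz : IsNucleus z) (hf : Measurable f)
    (hfinv : ∀ C x, f (shift x C) = f C) {ρ : ℝ} (hρ : 0 < ρ) (u : ℝ) :
    1 - ρ * P'.real {ω' | u < f (𝒞 ω')} ≤ probMaxLe P 𝔪 z f ρ u := by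
  have h := one_sub_le_probLe hprod h𝔪 hz hf hfinv (measurableSet_window hρ)
    (volume_window_ne_top hρ.le) u
  rwa [volumeReal_window hd hρ.le] at h

theorem tendsto_probMaxLe_threshold_sub_pow (hd : 1 ≤ d)
    (hprod : HasProductIntensity P P' 𝔪 z 𝒞)
    (h𝔪 : Measurable 𝔪) (hstat : IsStationary P 𝔪)
    (hz : IsNucleus z) (hf : Measurable f) (h𝒞 : Measurable 𝒞)
    (hfinv : ∀ C x, f (shift x C) = f C)
    {a : E d} {s : ℝ} (hs : 0 < s) (ha : ∀ r, a r ≤ 0 ∧ 1 ≤ a r + s)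
    {n : ℝ → ℕ} (hn : Tendsto n atTop atTop) (hR : RDependent P 𝔪 z f a s n)
    {v : ℝ → ℝ → ℝ} (hv : AreThresholds P' 𝒞 f v) {k : ℕ} (hk : 0 < k) {τ : ℝ} (hτ : 0 ≤ τ) :
    Tendsto (fun ρ => probMaxLe P 𝔪 z f ρ (v τ ρ) -
      probMaxLe P 𝔪 z f (ρ / (k : ℝ) ^ d) (v (τ / (k : ℝ) ^ d) (ρ / (k : ℝ) ^ d)) ^ (k ^ d))
      atTop (𝓝 0) := by
  have hK : (0 : ℝ) < (k : ℝ) ^ d := by positivity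
  have h1 := tendsto_probMaxLe_sub_pow hd hprod h𝔪 hstat hz hf hfinv hs ha hn hR (hv τ hτ) hk
  have hdiv : Tendsto (fun ρ : ℝ => ρ / (k : ℝ) ^ d) atTop atTop := tendsto_id.atTop_div_const hK
  -- The large-window threshold yields τ / k^d mean exceedances in a block in the limit, just as the
  -- block's own threshold does, so the two can be exchanged.
  have h2 : Tendsto (fun ρ : ℝ => ρ / (k : ℝ) ^ d * P'.real {ω' | v τ ρ < f (𝒞 ω')}) atTop
      (𝓝 (τ / (k : ℝ) ^ d)) := by
    refine ((hv τ hτ).div_const ((k : ℝ) ^ d)).congr fun ρ => ?_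
    ring
  have h3 := (hv (τ / (k : ℝ) ^ d) (by positivity)).comp hdiv
  have h4 := ((h2.sub h3).abs).const_mul (((k ^ d : ℕ) : ℝ))
  rw [sub_self, abs_zero, mul_zero] at h4
  have h5 : Tendsto (fun ρ => probMaxLe P 𝔪 z f (ρ / (k : ℝ) ^ d) (v τ ρ) ^ (k ^ d) -
      probMaxLe P 𝔪 z f (ρ / (k : ℝ) ^ d) (v (τ / (k : ℝ) ^ d) (ρ / (k : ℝ) ^ d)) ^ (k ^ d))
      atTop (𝓝 0) := by
    refine squeeze_zero_norm' ?_ h4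
    filter_upwards [eventually_gt_atTop 0] with ρ hρ
    refine (abs_pow_sub_pow_le (probMaxLe_mem_Icc _ _) (probMaxLe_mem_Icc _ _) _).trans ?_
    exact mul_le_mul_of_nonneg_left
      (abs_probMaxLe_sub_le hd hprod h𝔪 hz hf h𝒞 hfinv (div_pos hρ hK) _ _) (Nat.cast_nonneg _)
  simpa using h1.add h5

theorem exists_limitFunctional_probMaxLe_eq_exp (hd : 1 ≤ d)
    (hprod : HasProductIntensity P P' 𝔪 z 𝒞)
    (h𝔪 : Measurable 𝔪) (hstat : IsStationary P 𝔪)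
    (hz : IsNucleus z) (hf : Measurable f) (h𝒞 : Measurable 𝒞)
    (hfinv : ∀ C x, f (shift x C) = f C)
    {a : E d} {s : ℝ} (hs : 0 < s) (ha : ∀ r, a r ≤ 0 ∧ 1 ≤ a r + s)
    {n : ℝ → ℕ} (hn : Tendsto n atTop atTop) (hR : RDependent P 𝔪 z f a s n)
    {v : ℝ → ℝ → ℝ} (hv : AreThresholds P' 𝒞 f v) {Λ : (ℝ → ℝ) → ℝ} (hΛ : IsLimitFunctional Λ) :
    ∃ θ : ℝ, 0 ≤ θ ∧ θ ≤ 1 ∧ ∀ τ, 0 ≤ τ →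
      Λ (fun ρ => probMaxLe P 𝔪 z f ρ (v τ ρ)) = Real.exp (-θ * τ) := by
  refine exists_limitFunctional_eq_exp hd hΛ (g := fun τ ρ => probMaxLe P 𝔪 z f ρ (v τ ρ))
    (fun τ ρ => probMaxLe_mem_Icc _ _) (fun τ hτ => ⟨_, hv τ hτ, ?_⟩)
    (fun τ τ' hτ hτ' => ⟨_, ((hv τ hτ).sub (hv τ' hτ')).abs, ?_⟩)
    (fun k hk τ hτ =>
      tendsto_probMaxLe_threshold_sub_pow hd hprod h𝔪 hstat hz hf h𝒞 hfinv hs ha hn hR hv hk hτ)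
  · filter_upwards [eventually_gt_atTop 0] with ρ hρ
    linarith [one_sub_le_probMaxLe hd hprod h𝔪 hz hf hfinv hρ (v τ ρ)]
  · filter_upwards [eventually_gt_atTop 0] with ρ hρ
    linarith [le_abs_self (probMaxLe P 𝔪 z f ρ (v τ ρ) - probMaxLe P 𝔪 z f ρ (v τ' ρ)),
      abs_probMaxLe_sub_le hd hprod h𝔪 hz hf h𝒞 hfinv hρ (v τ ρ) (v τ' ρ)]

end

end RandomTessellation

theorem proposition1 {d : ℕ} (hd : 1 ≤ d)
    {Ω Ω' : Type*} [MeasurableSpace Ω] [MeasurableSpace Ω']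
    (P : Measure Ω) [IsProbabilityMeasure P] (P' : Measure Ω') [IsProbabilityMeasure P']
    -- the random tessellation, its nuclei, and its typical cell
    (𝔪 : Ω → RandomTessellation.Tessellation d) (h𝔪 : Measurable 𝔪)
    (hstat : RandomTessellation.IsStationary P 𝔪)
    (z : RandomTessellation.Tessellation d → RandomTessellation.Body d → RandomTessellation.E d)
    (hz : RandomTessellation.IsNucleus z)
    (B : Set (RandomTessellation.E d)) (hB : MeasurableSet B)
    (hB0 : volume B ≠ 0) (hBtop : volume B ≠ ∞)
    (hint : RandomTessellation.intensity P 𝔪 z B = 1)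
    (𝒞 : Ω' → RandomTessellation.Body d)
    (h𝒞 : RandomTessellation.IsTypicalCell P 𝔪 z B P' 𝒞)
    -- the geometric characteristic
    (f : RandomTessellation.Body d → ℝ) (hf : Measurable f)
    (hfinv : ∀ (C : RandomTessellation.Body d) (x : RandomTessellation.E d),
      f (RandomTessellation.shift x C) = f C)
    -- a cube containing `[0,1]^d`, and its subdivisions into `(n ρ)^d` sub-cubes
    (a : RandomTessellation.E d) (s : ℝ)
    (hcube : RandomTessellation.cube (0 : RandomTessellation.E d) 1 ⊆
      RandomTessellation.cube a s)
    (n : ℝ → ℕ) (hn : Tendsto n atTop atTop)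
    (hR : RandomTessellation.RDependent P 𝔪 z f a s n)
    -- the thresholds
    (v : ℝ → ℝ → ℝ) (hv : RandomTessellation.AreThresholds P' 𝒞 f v) :
    ∃ θ θ' : ℝ, 0 ≤ θ ∧ θ ≤ θ' ∧ θ' ≤ 1 ∧
      (∀ τ : ℝ, 0 ≤ τ →
        limsup (fun ρ : ℝ => RandomTessellation.probMaxLe P 𝔪 z f ρ (v τ ρ)) atTop =
            Real.exp (-θ * τ) ∧
        liminf (fun ρ : ℝ => RandomTessellation.probMaxLe P 𝔪 z f ρ (v τ ρ)) atTop =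
            Real.exp (-θ' * τ)) ∧
      ∀ τ : ℝ, 0 < τ →
        (∃ l : ℝ, Tendsto (fun ρ : ℝ => RandomTessellation.probMaxLe P 𝔪 z f ρ (v τ ρ))
          atTop (𝓝 l)) →
        θ = θ' ∧ RandomTessellation.HasExtremalIndex P 𝔪 z P' 𝒞 f v θ := by
  
  have hprod : RandomTessellation.HasProductIntensity P P' 𝔪 z 𝒞 := fun G hG hinv S hS =>
    RandomTessellation.meanCount_eq h𝔪 hstat hz hB hB0 hBtop h𝒞 hG hinv hS
  have ha := RandomTessellation.bounds_of_cube_subset hcube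
  have hs : 0 < s := by linarith [(ha ⟨0, hd⟩).1, (ha ⟨0, hd⟩).2]
  obtain ⟨θ, hθ0, hθ1, hθ⟩ := RandomTessellation.exists_limitFunctional_probMaxLe_eq_exp hd hprod
    h𝔪 hstat hz hf h𝒞.measurable hfinv hs ha hn hR hv
    RandomTessellation.isLimitFunctional_limsup
  obtain ⟨θ', hθ0', hθ1', hθ'⟩ := RandomTessellation.exists_limitFunctional_probMaxLe_eq_exp hd
    hprod h𝔪 hstat hz hf h𝒞.measurable hfinv hs ha hn hR hv
    RandomTessellation.isLimitFunctional_liminf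
  have hbdd : ∀ τ, IsBoundedUnder (· ≤ ·) atTop
      fun ρ : ℝ => RandomTessellation.probMaxLe P 𝔪 z f ρ (v τ ρ) := fun τ =>
    isBoundedUnder_of ⟨1, fun ρ => (RandomTessellation.probMaxLe_mem_Icc ρ (v τ ρ)).2⟩
  have hbdd' : ∀ τ, IsBoundedUnder (· ≥ ·) atTop
      fun ρ : ℝ => RandomTessellation.probMaxLe P 𝔪 z f ρ (v τ ρ) := fun τ =>
    isBoundedUnder_of ⟨0, fun ρ => (RandomTessellation.probMaxLe_mem_Icc ρ (v τ ρ)).1⟩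
  -- The exponential exp(-θτ) decreases in θ, so the upper limit carries the smaller constant; τ = 1
  -- suffices to compare.
  have hle : θ ≤ θ' := by
    have h := liminf_le_limsup (hbdd 1) (hbdd' 1)
    have h1 := hθ 1 zero_le_one
    have h2 := hθ' 1 zero_le_one
    rw [h1, h2, Real.exp_le_exp] at h
    linarith
  refine ⟨θ, θ', hθ0, hle, hθ1', fun τ hτ => ⟨hθ τ hτ, hθ' τ hτ⟩, ?_⟩
  rintro τ hτ ⟨l, hl⟩
  have heq : θ = θ' := by
    have h : Real.exp (-θ * τ) = Real.exp (-θ' * τ) :=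
      ((hθ τ hτ.le).symm.trans hl.limsup_eq).trans (hl.liminf_eq.symm.trans (hθ' τ hτ.le))
    have h2 := mul_right_cancel₀ hτ.ne' (Real.exp_injective h)
    linarith
  refine ⟨heq, hv, fun σ hσ => ?_⟩
  exact tendsto_of_liminf_eq_limsup (heq ▸ hθ' σ hσ) (hθ σ hσ) (hbdd σ) (hbdd' σ)
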